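/- For an embedded surface $S\subset\mathbb R^3$ without boundary, with area element $d^2y$, principal curvatures $\kappa_1,\kappa_2$, $\Delta=(\kappa_1-\kappa_2)^2$ and Gauss curvature $K=\kappa_1\kappa_2$, the Auckly–Sadun renormalized $r^{-4}$-potential at $x\in S$ and the renormalized $r^{-4}$-potential energy are $$V(x;S)=\lim_{\varepsilon\to0^+}\left(\int_{S\setminus B_\varepsilon(x)}\frac{d^2y}{|x-y|^4}-\frac{\pi}{\varepsilon^2}+\frac{\pi\Delta(x)}{16}\log\left(\Delta(x)\varepsilon^2\right)+\frac{\pi K(x)}{4}\right),\qquad E(S)=\int_S V(x;S)\,d^2x,$$ where $B_\varepsilon(x)$ is the ball with centre $x$ and radius $\varepsilon$, and $\Delta\log(\Delta\varepsilon^2)$ is read as $0$ where $\Delta=0$. Theorem. Let $R>1$ and let $T_R$ be the torus of revolution whose generating circle has radius $1$ and centre at distance $R$ from the axis, that is, the set of all points $$p(\alpha,\beta)=\big((R+\cos\alpha)\cos\beta,\ (R+\cos\alpha)\sin\beta,\ \sin\alpha\big),\qquad \alpha,\beta\in\mathbb R.$$ Then the potential exists at every point of $T_R$, namely $$V(p(\alpha,\beta);T_R)=\frac{3\pi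 R^2\log 2}{8(R+\cos\alpha)^2}-\frac{\pi}{8}-\frac{\pi}{4R^2(R+\cos\alpha)^2}+\frac{\pi(1+\sin^2\alpha)}{8(R+\cos\alpha)^2}+\frac{\pi\cos\alpha}{4(R+\cos\alpha)},$$ it is integrable over $T_R$, and the energy is $$E(T_R)=\frac{\pi^3}{2\sqrt{R^2-1}}\left(R^2(3\log 2-1)+2-\frac{2}{R^2}\right).$$ -/

import Mathlib

open scoped MeasureTheory ContDiff Topology RealInnerProductSpace

noncomputable section

namespace RenormalizedEnergy

/-- Euclidean three-space. -/
abbrev E3 : Type := EuclideanSpace ℝ (Fin 3)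

/-- The partial derivative of `φ` in the first parameter. -/
def partialU (φ : ℝ × ℝ → E3) (z : ℝ × ℝ) : E3 := fderiv ℝ φ z (1, 0)

/-- The partial derivative of `φ` in the second parameter. -/
def partialV (φ : ℝ × ℝ → E3) (z : ℝ × ℝ) : E3 := fderiv ℝ φ z (0, 1)

/-- `φ`, restricted to the open set `U`, is a local parametrization of an embedded surface `S`:
a smooth immersion which is a homeomorphism of `U` onto a relatively open subset of `S`. -/
structure IsLocalParametrization (S : Set E3) (φ : ℝ × ℝ → E3) (U : Set (ℝ × ℝ)) : Prop where
  isOpen_domain : IsOpen U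
  contDiffOn : ContDiffOn ℝ ∞ φ U
  immersion : ∀ z ∈ U, LinearIndependent ℝ ![partialU φ z, partialV φ z]
  isEmbedding : Topology.IsEmbedding (fun z : U => φ z)
  relOpen_image : ∃ W : Set E3, IsOpen W ∧ φ '' U = S ∩ W

/-- The matrix of the first fundamental form. -/
def firstForm (φ : ℝ × ℝ → E3) (z : ℝ × ℝ) : Matrix (Fin 2) (Fin 2) ℝ :=
  !![⟪partialU φ z, partialU φ z⟫, ⟪partialU φ z, partialV φ z⟫;
     ⟪partialU φ z, partialV φ z⟫, ⟪partialV φ z, partialV φ z⟫]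

/-- The matrix of the second fundamental form with respect to the normal vector `n`. -/
def secondForm (φ : ℝ × ℝ → E3) (z : ℝ × ℝ) (n : E3) : Matrix (Fin 2) (Fin 2) ℝ :=
  !![⟪partialU (partialU φ) z, n⟫, ⟪partialU (partialV φ) z, n⟫;
     ⟪partialU (partialV φ) z, n⟫, ⟪partialV (partialV φ) z, n⟫]

/-- `κ₁` and `κ₂` are the principal curvatures of `S` at `x`: in a local parametrization around `x`
and for a unit normal `n` they are, with multiplicity, the roots `t` of `det (II - t I) = 0`.
They are determined by `S` and `x` up to their order and up to a common sign (the choice of `n`),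
and neither affects `(κ₁ - κ₂) ^ 2` and `κ₁ * κ₂`. -/
def HasPrincipalCurvatures (S : Set E3) (x : E3) (κ₁ κ₂ : ℝ) : Prop :=
  ∃ (φ : ℝ × ℝ → E3) (U : Set (ℝ × ℝ)) (z : ℝ × ℝ) (n : E3),
    IsLocalParametrization S φ U ∧ z ∈ U ∧ φ z = x ∧
    ‖n‖ = 1 ∧ ⟪partialU φ z, n⟫ = 0 ∧ ⟪partialV φ z, n⟫ = 0 ∧
    ∀ t : ℝ, (secondForm φ z n - t • firstForm φ z).det =
      (firstForm φ z).det * ((t - κ₁) * (t - κ₂))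

/-- The integral of `|x - y|⁻⁴` over `S` outside the ball of radius `ε` about `x`; the area on `S`
is the two-dimensional Hausdorff measure, normalized to be Lebesgue measure on planes. -/
def truncatedPotential (S : Set E3) (x : E3) (ε : ℝ) : ℝ :=
  ∫ y in S \ Metric.ball x ε, 1 / ‖x - y‖ ^ 4 ∂μHE[2]

/-- `v` is the renormalized `r⁻⁴`-potential `V(x; S)`. Here `(κ₁ - κ₂) ^ 2` is `Δ(x)` and `κ₁ * κ₂`
is the Gauss curvature `K(x)`. -/
def HasRenormalizedPotential (S : Set E3) (x : E3) (v : ℝ) : Prop :=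
  ∃ κ₁ κ₂ : ℝ, HasPrincipalCurvatures S x κ₁ κ₂ ∧
    (∀ ε : ℝ, 0 < ε →
      MeasureTheory.IntegrableOn (fun y : E3 => 1 / ‖x - y‖ ^ 4) (S \ Metric.ball x ε) μHE[2]) ∧
    Filter.Tendsto
      (fun ε : ℝ => truncatedPotential S x ε - Real.pi / ε ^ 2
        + Real.pi * (κ₁ - κ₂) ^ 2 / 16 * Real.log ((κ₁ - κ₂) ^ 2 * ε ^ 2)
        + Real.pi * (κ₁ * κ₂) / 4)
      (𝓝[>] 0) (𝓝 v)

/-- `e` is the renormalized `r⁻⁴`-potential energy `E(S)`: the potential exists at every point of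
`S`, is integrable over `S`, and its integral over `S` is `e`. -/
def HasRenormalizedEnergy (S : Set E3) (e : ℝ) : Prop :=
  ∃ V : E3 → ℝ, (∀ x ∈ S, HasRenormalizedPotential S x (V x)) ∧
    MeasureTheory.IntegrableOn V S μHE[2] ∧ ∫ x in S, V x ∂μHE[2] = e

/-- The point with angle `u` on the generating circle (radius `1`, centre at distance `R` from the
third coordinate axis) rotated through the angle `v` about that axis. -/
def torusPoint (R u v : ℝ) : E3 :=
  !₂[(R + Real.cos u) * Real.cos v, (R + Real.cos u) * Real.sin v, Real.sin u]

/-- The torus of revolution `T_R`. -/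
def torus (R : ℝ) : Set E3 := {x | ∃ u v : ℝ, x = torusPoint R u v}

end RenormalizedEnergy

end

/-!
The idea is that the kernel `d²y / |x - y|⁴` on a torus of revolution becomes a rational function in
suitable coordinates around any point `x`, and that its radial integral in these coordinates is
elementary, so that the divergent terms can be split off exactly.

Area. The parametrization `(u, v) ↦ p(u, v)` is, near `(u₀, v₀)`, bi-Lipschitz with constants close
to `1` with respect to `(u, v) ↦ (u, (R + cos u₀) v)`, by the chord formula `dist_sq_torusPoint`.
Covering a period square by countably many such neighbourhoods identifies the Hausdorff measure on
the torus with `(R + cos u) du dv` (`map_withDensity_torusMap`).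

Rational coordinates. With `c = R + cos α`, `s = sin α` and
`u = α + 2 arctan (c τ / (1 + s τ))`, `v = β + 2 arctan σ`, one has
`|x - y|² = 4 c² Q / M` and `d²y / |x - y|⁴ = (4 c²)⁻¹ (1 + (R² - 1) τ²) (1 + σ²) / Q² dτ dσ`, where
`Q = τ² + σ² + R² τ² σ²` and `M = (1 + σ²) (1 + 2 s τ + (s² + c²) τ²)`
(`lintegral_torus_diff_ball`). The kernel no longer depends on `x`, up to the constant factor; only
the shape of the excised disc `M > L² Q`, with `L = 2 c / ε`, does.

Radial integral. In polar coordinates `τ = r cos θ`, `σ = r sin θ` the radial integral has an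
elementary primitive in `w = r⁻²` (`radialPrimitive`), with a linear and a logarithmic term. The ray
in the direction `θ` leaves the excised disc at `w = W`, where `√W` solves a quadratic equation up
to an error `O(1 / L)`; monotonicity in the cutoff reduces the claim to the exact solutions of two
nearby quadratic equations (`rayCutoff_bounds`). Averaging over `θ`, the term of order `L` cancels by
antisymmetry, and the remaining terms are `π L²`, `π R² log L / 2` and a constant, which involves
`∫ g log p dθ` with `p = R² cos² θ sin² θ` (`integral_rayG_mul_logRayP`); this is evaluated by parts
from `∫ log sin`. The result is `exists_abs_truncated_sub_le`.

The principal curvatures at `p(α, β)` are `1` and `cos α / (R + cos α)`, so that `Δ = R² / c²`, and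
the counterterms in the definition of the potential match these terms. The potential times
`R + cos α` is a constant multiple of `1 / (R + cos α)`, whose integral over a period is
`2 π / √(R² - 1)`; this gives the energy.
-/

noncomputable section

namespace RenormalizedEnergy

open MeasureTheory Set Filter
open scoped ENNReal NNReal

/-! ### The area element of the torus -/

/-- If `f` expands distances on `s` by a factor of at most `K` as compared with `g`, then the
Euclidean Hausdorff measures of the images of `s` compare with the factor `K ^ d`. -/
theorem euclideanHausdorffMeasure_image_le_of_edist_le {X Y Z : Type*} [EMetricSpace Y]
    [MeasurableSpace Y] [BorelSpace Y] [EMetricSpace Z] [MeasurableSpace Z] [BorelSpace Z]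
    {f : X → Y} {g : X → Z} {s : Set X} {K : ℝ≥0}
    (h : ∀ x ∈ s, ∀ y ∈ s, edist (f x) (f y) ≤ K * edist (g x) (g y)) (d : ℕ) :
    μHE[d] (f '' s) ≤ (K : ℝ≥0∞) ^ d * μHE[d] (g '' s) := by
  -- `f` factors on `s` through a Lipschitz map of `g '' s`
  rcases s.eq_empty_or_nonempty with rfl | ⟨x₀, hx₀⟩
  · simp
  have : Nonempty X := ⟨x₀⟩
  have hinv : ∀ x ∈ s, Function.invFunOn g s (g x) ∈ s ∧ g (Function.invFunOn g s (g x)) = g x :=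
    fun x hx => Function.invFunOn_pos ⟨x, hx, rfl⟩
  have hLip : LipschitzOnWith K (f ∘ Function.invFunOn g s) (g '' s) := by
    rintro _ ⟨x, hx, rfl⟩ _ ⟨y, hy, rfl⟩
    have := h _ (hinv x hx).1 _ (hinv y hy).1
    rwa [(hinv x hx).2, (hinv y hy).2] at this
  have himage : (f ∘ Function.invFunOn g s) '' (g '' s) = f '' s := by
    rw [image_image]
    refine image_congr fun x hx => ?_
    have := h _ (hinv x hx).1 _ hx
    rw [(hinv x hx).2, edist_self, mul_zero] at this
    exact edist_le_zero.1 this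
  have := hLip.hausdorffMeasure_image_le (d := d) (by positivity)
  rw [himage] at this
  simp only [Measure.euclideanHausdorffMeasure_def, Measure.smul_apply, ENNReal.smul_def,
    smul_eq_mul]
  rw [mul_left_comm]
  gcongr
  simpa using this

/-- The linear map `(u, v) ↦ (u, c v)` to the Euclidean plane; for `c = R + cos u₀` it is, up to a
linear isometry, the derivative of the torus parametrization at `(u₀, v₀)`. -/
def scaledPlane (c : ℝ) (z : ℝ × ℝ) : EuclideanSpace ℝ (Fin 2) := !₂[z.1, c * z.2]

theorem euclideanHausdorffMeasure_scaledPlane_image {c : ℝ} (hc : 0 < c) (s : Set (ℝ × ℝ)) :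
    μHE[2] (scaledPlane c '' s) = ENNReal.ofReal c * volume s := by
  have himage : scaledPlane c '' s = ((MeasurableEquiv.finTwoArrow (α := ℝ)).symm.trans
      (MeasurableEquiv.toLp 2 (Fin 2 → ℝ))) ''
        ((LinearMap.prodMap (LinearMap.id) (c • LinearMap.id) : ℝ × ℝ →ₗ[ℝ] ℝ × ℝ) '' s) := by
    rw [image_image]
    refine image_congr fun z _ => ?_
    simp [scaledPlane, MeasurableEquiv.finTwoArrow]
  have hmp : MeasurePreserving ((MeasurableEquiv.finTwoArrow (α := ℝ)).symm.trans
      (MeasurableEquiv.toLp 2 (Fin 2 → ℝ))) :=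
    (PiLp.volume_preserving_toLp (Fin 2)).comp (volume_preserving_finTwoArrow ℝ).symm
  rw [EuclideanSpace.euclideanHausdorffMeasure_eq_volume, himage, MeasurableEquiv.image_eq_preimage_symm,
    hmp.symm.measure_preimage_equiv, Measure.addHaar_image_linearMap, LinearMap.det_prodMap]
  simp [abs_of_pos hc]

theorem dist_sq_torusPoint (R u v u' v' : ℝ) :
    dist (torusPoint R u v) (torusPoint R u' v') ^ 2 = 2 * (1 - Real.cos (u - u'))
      + 2 * ((R + Real.cos u) * (R + Real.cos u')) * (1 - Real.cos (v - v')) := by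
  rw [EuclideanSpace.dist_eq, Real.sq_sqrt (by positivity)]
  simp only [Fin.sum_univ_three, torusPoint, Real.dist_eq, sq_abs, Real.cos_sub]
  simp
  linear_combination (R + Real.cos u) ^ 2 * Real.sin_sq_add_cos_sq v
    + (R + Real.cos u') ^ 2 * Real.sin_sq_add_cos_sq v' + Real.sin_sq_add_cos_sq u
    + Real.sin_sq_add_cos_sq u'

theorem dist_sq_scaledPlane (c : ℝ) (z z' : ℝ × ℝ) :
    dist (scaledPlane c z) (scaledPlane c z') ^ 2 = (z.1 - z'.1) ^ 2 + c ^ 2 * (z.2 - z'.2) ^ 2 := by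
  rw [EuclideanSpace.dist_eq, Real.sq_sqrt (by positivity)]
  simp [scaledPlane, Real.dist_eq, sq_abs]
  ring

theorem exists_sq_le_mul_one_sub_cos {K : ℝ} (hK : 1 < K) :
    ∃ δ > 0, ∀ x : ℝ, |x| < δ → x ^ 2 ≤ K * (2 * (1 - Real.cos x)) := by
  -- `2 (1 - cos x) ≥ x ^ 2 (1 - x ^ 2)` for `|x| ≤ 1`, so it suffices that `x ^ 2 ≤ 1 - 1 / K`
  refine ⟨min 1 (1 - 1 / K), lt_min one_pos (by rw [sub_pos, div_lt_one (by linarith)]; exact hK),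
    fun x hx => ?_⟩
  have h1 : |x| ≤ 1 := (hx.trans_le (min_le_left _ _)).le
  have h2 : |x| ≤ 1 - 1 / K := (hx.trans_le (min_le_right _ _)).le
  have h3 := (abs_le.1 (Real.cos_bound h1)).2
  have h4 : |x| ^ 4 = |x| ^ 2 * |x| ^ 2 := by ring
  have h5 : |x| ^ 2 ≤ 1 - 1 / K := by nlinarith [abs_nonneg x]
  have h6 : |x| ^ 4 ≤ x ^ 2 * (1 - 1 / K) := by
    rw [h4, ← sq_abs x]; gcongr
  have h7 : x ^ 2 * (1 / K) ≤ 2 * (1 - Real.cos x) := by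
    nlinarith [sq_nonneg x, pow_nonneg (abs_nonneg x) 4]
  calc x ^ 2 = K * (x ^ 2 * (1 / K)) := by field_simp
    _ ≤ _ := by gcongr

/-- Near `z₀` the torus parametrization is bi-Lipschitz with constants close to `1` when the
parameter plane is rescaled by its derivative at `z₀`. -/
theorem eventually_biLipschitz_torusPoint {R : ℝ} (hR : 1 < R) {K : ℝ} (hK : 1 < K) (z₀ : ℝ × ℝ) :
    ∃ U : Set (ℝ × ℝ), IsOpen U ∧ z₀ ∈ U ∧
      (∀ z ∈ U, R + Real.cos z.1 ≤ K * (R + Real.cos z₀.1) ∧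
        R + Real.cos z₀.1 ≤ K * (R + Real.cos z.1)) ∧
      ∀ z ∈ U, ∀ z' ∈ U,
        dist (torusPoint R z.1 z.2) (torusPoint R z'.1 z'.2)
          ≤ K * dist (scaledPlane (R + Real.cos z₀.1) z) (scaledPlane (R + Real.cos z₀.1) z') ∧
        dist (scaledPlane (R + Real.cos z₀.1) z) (scaledPlane (R + Real.cos z₀.1) z')
          ≤ K ^ 2 * dist (torusPoint R z.1 z.2) (torusPoint R z'.1 z'.2) := by
  obtain ⟨δ, hδ, hcos⟩ := exists_sq_le_mul_one_sub_cos hK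
  set c := R + Real.cos z₀.1 with hc
  have hc0 : 0 < c := by linarith [Real.neg_one_le_cos z₀.1]
  have hK0 : 0 < K := by linarith
  have hopen : IsOpen {z : ℝ × ℝ | R + Real.cos z.1 < K * c ∧ c < K * (R + Real.cos z.1)} :=
    have hcont : Continuous fun z : ℝ × ℝ => R + Real.cos z.1 := by fun_prop
    IsOpen.inter (isOpen_lt hcont continuous_const) (isOpen_lt continuous_const (hcont.const_mul K))
  refine ⟨{z | R + Real.cos z.1 < K * c ∧ c < K * (R + Real.cos z.1)} ∩ Metric.ball z₀ (δ / 2),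
    IsOpen.inter hopen Metric.isOpen_ball,
    ⟨⟨?_, ?_⟩, Metric.mem_ball_self (by linarith)⟩, fun z hz => ⟨hz.1.1.le, hz.1.2.le⟩, ?_⟩
  · show c < K * c
    nlinarith
  · show c < K * c
    nlinarith
  rintro z ⟨⟨h1, h2⟩, hz⟩ z' ⟨⟨h1', h2'⟩, hz'⟩
  have hd : dist z z' < δ := by
    have := dist_triangle_right z z' z₀
    rw [Metric.mem_ball] at hz hz'
    linarith
  rw [Prod.dist_eq, max_lt_iff, Real.dist_eq, Real.dist_eq] at hd
  have hu := hcos _ hd.1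
  have hv := hcos _ hd.2
  have hu' := Real.one_sub_sq_div_two_le_cos (x := z.1 - z'.1)
  have hv' := Real.one_sub_sq_div_two_le_cos (x := z.2 - z'.2)
  have hT := dist_sq_torusPoint R z.1 z.2 z'.1 z'.2
  have hS := dist_sq_scaledPlane c z z'
  set A := R + Real.cos z.1
  set B := R + Real.cos z'.1
  set X := 2 * (1 - Real.cos (z.1 - z'.1))
  set Y := 2 * (1 - Real.cos (z.2 - z'.2))
  have hA : 0 < A := by nlinarith
  have hB : 0 < B := by nlinarith
  have hX : 0 ≤ X := by simp only [X]; linarith [Real.cos_le_one (z.1 - z'.1)]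
  have hY : 0 ≤ Y := by simp only [Y]; linarith [Real.cos_le_one (z.2 - z'.2)]
  have hT' : dist (torusPoint R z.1 z.2) (torusPoint R z'.1 z'.2) ^ 2 = X + A * B * Y := by
    rw [hT]; simp only [X, Y]; ring
  have hAB : A * B ≤ (K * c) * (K * c) := by gcongr
  have hAB' : c * c ≤ (K * A) * (K * B) := by gcongr
  constructor
  · refine abs_le_of_sq_le_sq' ?_ (by positivity) |>.2
    rw [mul_pow, hT', hS]
    calc X + A * B * Y ≤ (z.1 - z'.1) ^ 2 + (K * c) * (K * c) * (z.2 - z'.2) ^ 2 := by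
          gcongr
          · simp only [X]; linarith
          · simp only [Y]; linarith
      _ ≤ K ^ 2 * (z.1 - z'.1) ^ 2 + (K * c) * (K * c) * (z.2 - z'.2) ^ 2 := by
          gcongr
          exact le_mul_of_one_le_left (sq_nonneg _) (by nlinarith)
      _ = _ := by ring
  · refine abs_le_of_sq_le_sq' ?_ (by positivity) |>.2
    rw [mul_pow, hT', hS]
    have hK3 : K ^ 3 ≤ K ^ 4 := pow_le_pow_right₀ hK.le (by norm_num)
    calc (z.1 - z'.1) ^ 2 + c ^ 2 * (z.2 - z'.2) ^ 2
        ≤ K * X + (K * A) * (K * B) * (K * Y) := by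
          rw [sq c]
          gcongr
      _ = K * X + K ^ 3 * (A * B * Y) := by ring
      _ ≤ K ^ 4 * X + K ^ 4 * (A * B * Y) := by
          gcongr
          calc K = K ^ 1 := (pow_one K).symm
            _ ≤ K ^ 4 := pow_le_pow_right₀ hK.le (by norm_num)
      _ = _ := by ring

/-- The torus parametrization as a function on the plane. -/
def torusMap (R : ℝ) (z : ℝ × ℝ) : E3 := torusPoint R z.1 z.2

theorem continuous_torusMap (R : ℝ) : Continuous (torusMap R) := by
  unfold torusMap torusPoint
  fun_prop

/-- A period square of the torus parametrization. -/
def periodSquare (a b : ℝ) : Set (ℝ × ℝ) :=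
  Ioc (a - Real.pi) (a + Real.pi) ×ˢ Ioc (b - Real.pi) (b + Real.pi)

theorem measurableSet_periodSquare (a b : ℝ) : MeasurableSet (periodSquare a b) :=
  measurableSet_Ioc.prod measurableSet_Ioc

theorem eq_of_cos_sub_eq_one {a x y : ℝ} (hx : x ∈ Ioc (a - Real.pi) (a + Real.pi))
    (hy : y ∈ Ioc (a - Real.pi) (a + Real.pi)) (h : Real.cos (x - y) = 1) : x = y := by
  have := (Real.cos_eq_one_iff_of_lt_of_lt (by linarith [hx.1, hy.2]) (by linarith [hx.2, hy.1])).1 h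
  linarith

theorem injOn_torusMap {R : ℝ} (hR : 1 < R) (a b : ℝ) : InjOn (torusMap R) (periodSquare a b) := by
  rintro ⟨u, v⟩ ⟨hu, hv⟩ ⟨u', v'⟩ ⟨hu', hv'⟩ h
  have hd := dist_sq_torusPoint R u v u' v'
  have h' : torusPoint R u v = torusPoint R u' v' := h
  rw [h', dist_self] at hd
  have hA : 0 < R + Real.cos u := by linarith [Real.neg_one_le_cos u]
  have hB : 0 < R + Real.cos u' := by linarith [Real.neg_one_le_cos u']
  have h1 : 0 ≤ 1 - Real.cos (u - u') := by linarith [Real.cos_le_one (u - u')]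
  have h2 : 0 ≤ 1 - Real.cos (v - v') := by linarith [Real.cos_le_one (v - v')]
  have h3 : 0 ≤ ((R + Real.cos u) * (R + Real.cos u')) * (1 - Real.cos (v - v')) := by positivity
  have h4 : ((R + Real.cos u) * (R + Real.cos u')) * (1 - Real.cos (v - v')) = 0 := by linarith
  have h5 : 1 - Real.cos (v - v') = 0 := (mul_eq_zero.1 h4).resolve_left (by positivity)
  exact Prod.ext (eq_of_cos_sub_eq_one hu hu' (by linarith)) (eq_of_cos_sub_eq_one hv hv' (by linarith))

theorem image_torusMap_periodSquare (R a b : ℝ) : torusMap R '' periodSquare a b = torus R := by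
  ext x
  constructor
  · rintro ⟨z, -, rfl⟩
    exact ⟨z.1, z.2, rfl⟩
  · rintro ⟨u, v, rfl⟩
    have hper : ∀ c t : ℝ, ∃ t' ∈ Ioc (c - Real.pi) (c + Real.pi),
        Real.cos t = Real.cos t' ∧ Real.sin t = Real.sin t' := by
      intro c t
      have h := toIocMod_mem_Ioc Real.two_pi_pos (c - Real.pi) t
      refine ⟨toIocMod Real.two_pi_pos (c - Real.pi) t, ⟨h.1, by linarith [h.2]⟩, ?_, ?_⟩
      · rw [toIocMod, zsmul_eq_mul, Real.cos_sub_int_mul_two_pi]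
      · rw [toIocMod, zsmul_eq_mul, Real.sin_sub_int_mul_two_pi]
    obtain ⟨u', hu', hcu, hsu⟩ := hper a u
    obtain ⟨v', hv', hcv, hsv⟩ := hper b v
    exact ⟨(u', v'), ⟨hu', hv'⟩, by simp [torusMap, torusPoint, hcu, hsu, hcv, hsv]⟩

/-- The area density of the torus parametrization. -/
def torusDensity (R : ℝ) (z : ℝ × ℝ) : ℝ≥0∞ := ENNReal.ofReal (R + Real.cos z.1)

theorem measurable_torusDensity (R : ℝ) : Measurable (torusDensity R) := by
  unfold torusDensity
  fun_prop

/-- Up to a factor close to `1`, the area of the image of a small set is the integral of the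
density. -/
theorem exists_nhds_area_bounds {R : ℝ} (hR : 1 < R) {K : ℝ≥0} (hK : 1 < K) (z₀ : ℝ × ℝ) :
    ∃ U : Set (ℝ × ℝ), IsOpen U ∧ z₀ ∈ U ∧ ∀ A ⊆ U, MeasurableSet A →
      μHE[2] (torusMap R '' A) ≤ (K : ℝ≥0∞) ^ 5 * ∫⁻ z in A, torusDensity R z ∧
      ∫⁻ z in A, torusDensity R z ≤ (K : ℝ≥0∞) ^ 5 * μHE[2] (torusMap R '' A) := by
  obtain ⟨U, hU, hz₀, hdens, hlip⟩ :=
    eventually_biLipschitz_torusPoint hR (K := K) (by exact_mod_cast hK) z₀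
  refine ⟨U, hU, hz₀, fun A hA hAm => ?_⟩
  set c := R + Real.cos z₀.1 with hc
  have hc0 : 0 < c := by linarith [Real.neg_one_le_cos z₀.1]
  have hK1 : (1 : ℝ≥0∞) ≤ K := by exact_mod_cast hK.le
  have hsc := euclideanHausdorffMeasure_scaledPlane_image hc0 A
  have h1 : μHE[2] (torusMap R '' A) ≤ (K : ℝ≥0∞) ^ 2 * μHE[2] (scaledPlane c '' A) := by
    refine euclideanHausdorffMeasure_image_le_of_edist_le (fun z hz z' hz' => ?_) 2
    rw [edist_dist, edist_dist, ← ENNReal.ofReal_coe_nnreal, ← ENNReal.ofReal_mul (by positivity)]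
    exact ENNReal.ofReal_le_ofReal (hlip z (hA hz) z' (hA hz')).1
  have h2 : μHE[2] (scaledPlane c '' A) ≤ ((K ^ 2 : ℝ≥0) : ℝ≥0∞) ^ 2 * μHE[2] (torusMap R '' A) := by
    refine euclideanHausdorffMeasure_image_le_of_edist_le (fun z hz z' hz' => ?_) 2
    rw [edist_dist, edist_dist, ← ENNReal.ofReal_coe_nnreal, ← ENNReal.ofReal_mul (by positivity)]
    exact ENNReal.ofReal_le_ofReal (by simpa [torusMap] using (hlip z (hA hz) z' (hA hz')).2)
  have h3 : ENNReal.ofReal c * volume A ≤ K * ∫⁻ z in A, torusDensity R z := by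
    rw [← lintegral_const_mul _ (measurable_torusDensity R), ← setLIntegral_const]
    refine setLIntegral_mono' hAm fun z hz => ?_
    rw [torusDensity, ← ENNReal.ofReal_coe_nnreal, ← ENNReal.ofReal_mul (by positivity)]
    exact ENNReal.ofReal_le_ofReal (hdens z (hA hz)).2
  have h4 : ∫⁻ z in A, torusDensity R z ≤ K * (ENNReal.ofReal c * volume A) := by
    rw [← mul_assoc, ← setLIntegral_const]
    refine setLIntegral_mono' hAm fun z hz => ?_
    rw [torusDensity, ← ENNReal.ofReal_coe_nnreal, ← ENNReal.ofReal_mul (by positivity)]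
    exact ENNReal.ofReal_le_ofReal (hdens z (hA hz)).1
  constructor
  · calc _ ≤ (K : ℝ≥0∞) ^ 2 * (K * ∫⁻ z in A, torusDensity R z) := by
          refine h1.trans ?_
          rw [hsc]
          gcongr
      _ = (K : ℝ≥0∞) ^ 3 * ∫⁻ z in A, torusDensity R z := by ring
      _ ≤ _ := by
          gcongr ?_ * _
          exact pow_le_pow_right₀ hK1 (by norm_num)
  · calc _ ≤ (K : ℝ≥0∞) * (((K ^ 2 : ℝ≥0) : ℝ≥0∞) ^ 2 * μHE[2] (torusMap R '' A)) := by
          refine h4.trans ?_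
          rw [← hsc]
          gcongr
      _ = _ := by
          push_cast
          ring

theorem le_of_forall_one_lt_le_pow_mul {a b : ℝ≥0∞} (n : ℕ)
    (h : ∀ K : ℝ≥0, 1 < K → a ≤ (K : ℝ≥0∞) ^ n * b) : a ≤ b := by
  rcases eq_or_ne b ∞ with rfl | hb
  · exact le_top
  have hlim : Tendsto (fun K : ℝ≥0 => (K : ℝ≥0∞) ^ n * b) (𝓝[>] 1) (𝓝 ((1 : ℝ≥0∞) ^ n * b)) := by
    refine ENNReal.Tendsto.mul_const (ENNReal.Tendsto.pow ?_) (Or.inr hb)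
    exact (ENNReal.tendsto_coe.2 tendsto_id).mono_left nhdsWithin_le_nhds
  rw [one_pow, one_mul] at hlim
  refine ge_of_tendsto hlim ?_
  filter_upwards [self_mem_nhdsWithin] with K hK using h K hK

/-- The area of the image of a measurable part of a period square. -/
theorem euclideanHausdorffMeasure_image_torusMap {R : ℝ} (hR : 1 < R) {a b : ℝ} {A : Set (ℝ × ℝ)}
    (hA : A ⊆ periodSquare a b) (hAm : MeasurableSet A) :
    μHE[2] (torusMap R '' A) = ∫⁻ z in A, torusDensity R z := by
  have hinj : InjOn (torusMap R) A := (injOn_torusMap hR a b).mono hA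
  have key : ∀ K : ℝ≥0, 1 < K →
      μHE[2] (torusMap R '' A) ≤ (K : ℝ≥0∞) ^ 5 * ∫⁻ z in A, torusDensity R z ∧
      ∫⁻ z in A, torusDensity R z ≤ (K : ℝ≥0∞) ^ 5 * μHE[2] (torusMap R '' A) := by
    intro K hK
    choose U hUo hUz hU using exists_nhds_area_bounds hR hK
    obtain ⟨s, hsc, hs⟩ := TopologicalSpace.countable_cover_nhds (fun z => (hUo z).mem_nhds (hUz z))
    have hsne : s.Nonempty := by
      by_contra hne
      rw [not_nonempty_iff_eq_empty] at hne
      simp [hne] at hs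
      exact (empty_ne_univ hs).elim
    obtain ⟨e, rfl⟩ := hsc.exists_eq_range hsne
    rw [biUnion_range] at hs
    set t : ℕ → Set (ℝ × ℝ) := disjointed (fun n => U (e n)) with ht
    have htm : ∀ n, MeasurableSet (A ∩ t n) := fun n =>
      hAm.inter (MeasurableSet.disjointed (fun n => (hUo (e n)).measurableSet) n)
    have htd : Pairwise (Function.onFun Disjoint fun n => A ∩ t n) := fun i j hij =>
      (disjoint_disjointed _ hij).mono inter_subset_right inter_subset_right
    have htU : (⋃ n, A ∩ t n) = A := by
      rw [← inter_iUnion, ht, iUnion_disjointed, hs, inter_univ]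
    have himg : μHE[2] (torusMap R '' A) = ∑' n, μHE[2] (torusMap R '' (A ∩ t n)) := by
      conv_lhs => rw [← htU, image_iUnion]
      refine measure_iUnion (fun i j hij => ?_) (fun n => ?_)
      · exact (htd hij).image hinj inter_subset_left inter_subset_left
      · exact (htm n).image_of_continuousOn_injOn (continuous_torusMap R).continuousOn
          (hinj.mono inter_subset_left)
    have hint : ∫⁻ z in A, torusDensity R z = ∑' n, ∫⁻ z in A ∩ t n, torusDensity R z := by
      conv_lhs => rw [← htU]
      exact lintegral_iUnion htm htd _
    have hb := fun n => hU (e n) (A ∩ t n) (inter_subset_right.trans (disjointed_subset _ n)) (htm n)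
    rw [himg, hint, ← ENNReal.tsum_mul_left, ← ENNReal.tsum_mul_left]
    exact ⟨ENNReal.tsum_le_tsum fun n => (hb n).1, ENNReal.tsum_le_tsum fun n => (hb n).2⟩
  exact le_antisymm (le_of_forall_one_lt_le_pow_mul 5 fun K hK => (key K hK).1)
    (le_of_forall_one_lt_le_pow_mul 5 fun K hK => (key K hK).2)

/-- The area measure of the torus is the image of the density under the parametrization. -/
theorem map_withDensity_torusMap {R : ℝ} (hR : 1 < R) (a b : ℝ) :
    Measure.map (torusMap R) ((volume.restrict (periodSquare a b)).withDensity (torusDensity R))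
      = (μHE[2]).restrict (torus R) := by
  ext B hB
  have hP := (continuous_torusMap R).measurable hB
  rw [Measure.map_apply (continuous_torusMap R).measurable hB, withDensity_apply _ hP,
    Measure.restrict_apply hB, Measure.restrict_restrict hP,
    ← euclideanHausdorffMeasure_image_torusMap hR inter_subset_right
      (hP.inter (measurableSet_periodSquare a b)), image_preimage_inter, image_torusMap_periodSquare]

theorem lintegral_torus {R : ℝ} (hR : 1 < R) (a b : ℝ) {f : E3 → ℝ≥0∞} (hf : Measurable f) :
    ∫⁻ y in torus R, f y ∂μHE[2]
      = ∫⁻ z in periodSquare a b, torusDensity R z * f (torusMap R z) := by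
  rw [← map_withDensity_torusMap hR a b, lintegral_map hf (continuous_torusMap R).measurable,
    lintegral_withDensity_eq_lintegral_mul _ (measurable_torusDensity R)
      (g := fun z => f (torusMap R z)) (hf.comp (continuous_torusMap R).measurable)]
  rfl

/-! ### Rational coordinates around a point of the torus -/

/-- Up to a positive factor, the squared distance to the base point in the rational coordinates
`(τ, σ)`. -/
def chordForm (R : ℝ) (z : ℝ × ℝ) : ℝ := z.1 ^ 2 + z.2 ^ 2 + R ^ 2 * z.1 ^ 2 * z.2 ^ 2

/-- The density `d²y / |x - y|⁴` in the rational coordinates `(τ, σ)`, up to the constant factor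
`1 / (4 (R + cos α) ^ 2)`. -/
def torusKernel (R : ℝ) (z : ℝ × ℝ) : ℝ :=
  (1 + (R ^ 2 - 1) * z.1 ^ 2) * (1 + z.2 ^ 2) / chordForm R z ^ 2

/-- The conformal factor of the rational coordinates: the squared distance to the base point is
`4 (R + cos α) ^ 2` times `chordForm / chordFactor`, with `s = sin α` and
`k = sin α ^ 2 + (R + cos α) ^ 2`. -/
def chordFactor (s k : ℝ) (z : ℝ × ℝ) : ℝ := (1 + z.2 ^ 2) * (1 + 2 * s * z.1 + k * z.1 ^ 2)

/-- The angle on the generating circle as a function of the rational coordinate `τ` around the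
angle `α`, where `s = sin α` and `c = R + cos α`. -/
def circleAngle (α s c τ : ℝ) : ℝ := α + 2 * Real.arctan (c * τ / (1 + s * τ))

/-- The angle of rotation as a function of the rational coordinate `σ`. -/
def rotationAngle (β σ : ℝ) : ℝ := β + 2 * Real.arctan σ

theorem hasDerivAt_circleAngle (α : ℝ) {s c τ : ℝ} (hτ : 1 + s * τ ≠ 0) :
    HasDerivAt (circleAngle α s c) (2 * c / ((1 + s * τ) ^ 2 + c ^ 2 * τ ^ 2)) τ := by
  have h1 : HasDerivAt (fun τ => c * τ / (1 + s * τ))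
      ((c * 1 * (1 + s * τ) - c * τ * (s * 1)) / (1 + s * τ) ^ 2) τ :=
    ((hasDerivAt_id τ).const_mul c).div (((hasDerivAt_id τ).const_mul s).const_add 1) hτ
  refine ((h1.arctan.const_mul 2).const_add α).congr_deriv ?_
  have h2 : c * 1 * (1 + s * τ) - c * τ * (s * 1) = c := by ring
  rw [h2]
  generalize 1 + s * τ = D at hτ
  have h3 : D ^ 2 + c ^ 2 * τ ^ 2 ≠ 0 := by positivity
  have h4 : 1 + (c * τ / D) ^ 2 = (D ^ 2 + c ^ 2 * τ ^ 2) / D ^ 2 := by field_simp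
  rw [h4]
  field_simp

theorem hasDerivAt_rotationAngle (β σ : ℝ) :
    HasDerivAt (rotationAngle β) (2 / (1 + σ ^ 2)) σ :=
  (((Real.hasDerivAt_arctan σ).const_mul 2).const_add β).congr_deriv (by ring)

theorem cos_two_mul_arctan (t : ℝ) : Real.cos (2 * Real.arctan t) = (1 - t ^ 2) / (1 + t ^ 2) := by
  rw [Real.cos_two_mul, Real.cos_sq_arctan]
  field_simp
  ring

theorem sin_two_mul_arctan (t : ℝ) : Real.sin (2 * Real.arctan t) = 2 * t / (1 + t ^ 2) := by
  have h : Real.sin (Real.arctan t) = t * Real.cos (Real.arctan t) := by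
    have := Real.tan_mul_cos (Real.cos_arctan_pos t).ne'
    rw [Real.tan_arctan] at this
    exact this.symm
  rw [Real.sin_two_mul, h]
  linear_combination 2 * t * Real.cos_sq_arctan t

theorem cos_circleAngle_sub (α c : ℝ) {s τ : ℝ} (hτ : 1 + s * τ ≠ 0) :
    Real.cos (circleAngle α s c τ - α)
      = ((1 + s * τ) ^ 2 - c ^ 2 * τ ^ 2) / ((1 + s * τ) ^ 2 + c ^ 2 * τ ^ 2) := by
  rw [circleAngle, add_sub_cancel_left, cos_two_mul_arctan]
  generalize 1 + s * τ = D at hτ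
  have h3 : D ^ 2 + c ^ 2 * τ ^ 2 ≠ 0 := by positivity
  have h4 : 1 + (c * τ / D) ^ 2 = (D ^ 2 + c ^ 2 * τ ^ 2) / D ^ 2 := by field_simp
  rw [h4]
  field_simp

theorem sin_circleAngle_sub (α c : ℝ) {s τ : ℝ} (hτ : 1 + s * τ ≠ 0) :
    Real.sin (circleAngle α s c τ - α)
      = 2 * c * τ * (1 + s * τ) / ((1 + s * τ) ^ 2 + c ^ 2 * τ ^ 2) := by
  rw [circleAngle, add_sub_cancel_left, sin_two_mul_arctan]
  generalize 1 + s * τ = D at hτ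
  have h3 : D ^ 2 + c ^ 2 * τ ^ 2 ≠ 0 := by positivity
  have h4 : 1 + (c * τ / D) ^ 2 = (D ^ 2 + c ^ 2 * τ ^ 2) / D ^ 2 := by field_simp
  rw [h4]
  field_simp

/-- The distance of a point of the torus from the axis in the rational coordinate. -/
theorem add_cos_circleAngle (R α : ℝ) {τ : ℝ} (hτ : 1 + Real.sin α * τ ≠ 0) :
    R + Real.cos (circleAngle α (Real.sin α) (R + Real.cos α) τ)
      = (R + Real.cos α) * (1 + (R ^ 2 - 1) * τ ^ 2)
        / ((1 + Real.sin α * τ) ^ 2 + (R + Real.cos α) ^ 2 * τ ^ 2) := by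
  have h : circleAngle α (Real.sin α) (R + Real.cos α) τ
      = α + (circleAngle α (Real.sin α) (R + Real.cos α) τ - α) := by ring
  rw [h, Real.cos_add, cos_circleAngle_sub α _ hτ, sin_circleAngle_sub α _ hτ]
  have h2 : (1 + Real.sin α * τ) ^ 2 + (R + Real.cos α) ^ 2 * τ ^ 2 ≠ 0 := by positivity
  field_simp
  have := Real.sin_sq_add_cos_sq α
  linear_combination (-(R + Real.cos α) * τ ^ 2) * this

theorem dist_sq_circleAngle_rotationAngle (R α β σ : ℝ) {τ : ℝ} (hτ : 1 + Real.sin α * τ ≠ 0) :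
    dist (torusPoint R α β) (torusPoint R (circleAngle α (Real.sin α) (R + Real.cos α) τ)
      (rotationAngle β σ)) ^ 2
    = 4 * (R + Real.cos α) ^ 2 * chordForm R (τ, σ)
      / chordFactor (Real.sin α) (Real.sin α ^ 2 + (R + Real.cos α) ^ 2) (τ, σ) := by
  rw [dist_comm, dist_sq_torusPoint, cos_circleAngle_sub α _ hτ, add_cos_circleAngle R α hτ, rotationAngle,
    add_sub_cancel_left, cos_two_mul_arctan]
  have h2 : (1 + Real.sin α * τ) ^ 2 + (R + Real.cos α) ^ 2 * τ ^ 2 ≠ 0 := by positivity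
  have h4 : 1 + 2 * Real.sin α * τ + (Real.sin α ^ 2 + (R + Real.cos α) ^ 2) * τ ^ 2
      = (1 + Real.sin α * τ) ^ 2 + (R + Real.cos α) ^ 2 * τ ^ 2 := by ring
  simp only [chordFactor, chordForm]
  rw [h4]
  field_simp
  ring

theorem injOn_circleAngle (α s : ℝ) {c : ℝ} (hc : c ≠ 0) :
    InjOn (circleAngle α s c) {τ | 1 + s * τ ≠ 0} := by
  intro τ hτ τ' hτ' h
  have h1 : c * τ / (1 + s * τ) = c * τ' / (1 + s * τ') :=
    Real.arctan_injective (by simpa [circleAngle] using h)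
  rw [div_eq_div_iff hτ hτ'] at h1
  exact mul_left_cancel₀ hc (by linear_combination h1)

/-- The rational coordinate covers the circle except for the point opposite to `α` and the point
where `τ` is infinite. -/
theorem image_circleAngle_ae_eq (α s : ℝ) {c : ℝ} (hc : c ≠ 0) :
    circleAngle α s c '' {τ | 1 + s * τ ≠ 0} =ᵐ[volume] Ioc (α - Real.pi) (α + Real.pi) := by
  have hsub : circleAngle α s c '' {τ | 1 + s * τ ≠ 0} ⊆ Ioc (α - Real.pi) (α + Real.pi) := by
    rintro _ ⟨τ, -, rfl⟩
    have h1 := Real.arctan_lt_pi_div_two (c * τ / (1 + s * τ))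
    have h2 := Real.neg_pi_div_two_lt_arctan (c * τ / (1 + s * τ))
    constructor <;> simp only [circleAngle] <;> linarith
  have hsup : Ioc (α - Real.pi) (α + Real.pi) ⊆ circleAngle α s c '' {τ | 1 + s * τ ≠ 0}
      ∪ {α + Real.pi, α + 2 * Real.arctan (c / s)} := by
    intro u hu
    by_cases h1 : u = α + Real.pi
    · right; left; exact h1
    set t := Real.tan ((u - α) / 2) with ht
    have hat : Real.arctan t = (u - α) / 2 := by
      refine Real.arctan_tan (by linarith [hu.1]) ?_
      have : u < α + Real.pi := lt_of_le_of_ne hu.2 h1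
      linarith
    by_cases h2 : c - s * t = 0
    · right; right
      have hs : s ≠ 0 := by
        rintro rfl
        exact hc (by simpa using h2)
      have : c / s = t := by field_simp; linarith
      show u = _
      rw [this, hat]
      ring
    · left
      refine ⟨t / (c - s * t), ?_, ?_⟩
      · have : 1 + s * (t / (c - s * t)) = c / (c - s * t) := by field_simp; ring
        show _ ≠ _
        rw [this]
        exact div_ne_zero hc h2
      · have : c * (t / (c - s * t)) / (1 + s * (t / (c - s * t))) = t := by
          have : 1 + s * (t / (c - s * t)) = c / (c - s * t) := by field_simp; ring
          rw [this]
          generalize c - s * t = D at h2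
          field_simp
        rw [circleAngle, this, hat]
        ring
  refine Filter.EventuallyLE.antisymm hsub.eventuallyLE ?_
  refine (LE.le.eventuallyLE hsup).trans (union_ae_eq_left_of_ae_eq_empty ?_).le
  rw [ae_eq_empty]
  exact (Set.toFinite _).measure_zero _

theorem image_rotationAngle_ae_eq (β : ℝ) :
    rotationAngle β '' univ =ᵐ[volume] Ioc (β - Real.pi) (β + Real.pi) := by
  refine Filter.EventuallyEq.trans (Filter.Eventually.of_forall fun v => ?_) Ioo_ae_eq_Ioc
  refine propext ⟨?_, fun hv => ⟨Real.tan ((v - β) / 2), trivial, ?_⟩⟩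
  · rintro ⟨σ, -, rfl⟩
    have h1 := Real.arctan_lt_pi_div_two σ
    have h2 := Real.neg_pi_div_two_lt_arctan σ
    constructor <;> simp only [rotationAngle] <;> linarith
  · rw [rotationAngle, Real.arctan_tan (by linarith [hv.1]) (by linarith [hv.2])]
    ring

theorem setOf_one_add_mul_ne_zero_ae_eq_univ (s : ℝ) :
    {τ : ℝ | 1 + s * τ ≠ 0} =ᵐ[volume] (univ : Set ℝ) := by
  rw [ae_eq_univ]
  refine measure_mono_null (t := {-1 / s}) (fun τ hτ => ?_) (by simp)
  have hτ : 1 + s * τ = 0 := by simpa using hτ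
  have hs : s ≠ 0 := by
    rintro rfl
    simp at hτ
  show τ = -1 / s
  field_simp
  linarith

theorem lintegral_image_prodMap {f g f' g' : ℝ → ℝ} {S T : Set ℝ} (hS : MeasurableSet S)
    (hT : MeasurableSet T) (hf : ∀ x ∈ S, HasDerivAt f (f' x) x)
    (hg : ∀ x ∈ T, HasDerivAt g (g' x) x) (hfi : InjOn f S) (hgi : InjOn g T)
    (h : ℝ × ℝ → ℝ≥0∞) :
    ∫⁻ z in (f '' S) ×ˢ (g '' T), h z
      = ∫⁻ z in S ×ˢ T, ENNReal.ofReal |f' z.1 * g' z.2| * h (f z.1, g z.2) := by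
  have hderiv : ∀ z ∈ S ×ˢ T, HasFDerivWithinAt (Prod.map f g)
      ((ContinuousLinearMap.toSpanSingleton ℝ (f' z.1)).prodMap
        (ContinuousLinearMap.toSpanSingleton ℝ (g' z.2))) (S ×ˢ T) z := fun z hz =>
    (HasFDerivAt.prodMap z (hf _ hz.1).hasFDerivAt (hg _ hz.2).hasFDerivAt).hasFDerivWithinAt
  have hdet : ∀ x y : ℝ, ((ContinuousLinearMap.toSpanSingleton ℝ x).prodMap
      (ContinuousLinearMap.toSpanSingleton ℝ y)).det = x * y := by
    intro x y
    rw [ContinuousLinearMap.det, ContinuousLinearMap.coe_prodMap, LinearMap.det_prodMap]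
    simp
  rw [← prodMap_image_prod, lintegral_image_eq_lintegral_abs_det_fderiv_mul volume (hS.prod hT)
    hderiv (hfi.prodMap hgi)]
  refine setLIntegral_congr_fun (hS.prod hT) fun z _ => ?_
  simp only [hdet, Prod.map]

theorem measurableSet_one_add_mul_ne_zero (s : ℝ) : MeasurableSet {τ : ℝ | 1 + s * τ ≠ 0} :=
  (isOpen_ne_fun (by fun_prop) (by fun_prop)).measurableSet

/-- The change of variables to the rational coordinates. -/
theorem lintegral_periodSquare (α β s : ℝ) {c : ℝ} (hc : 0 < c) (g : ℝ × ℝ → ℝ≥0∞) :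
    ∫⁻ z in periodSquare α β, g z = ∫⁻ z in {τ | 1 + s * τ ≠ 0} ×ˢ univ,
      ENNReal.ofReal (2 * c / ((1 + s * z.1) ^ 2 + c ^ 2 * z.1 ^ 2) * (2 / (1 + z.2 ^ 2)))
        * g (circleAngle α s c z.1, rotationAngle β z.2) := by
  have hinj : InjOn (rotationAngle β) univ := fun σ _ σ' _ h =>
    Real.arctan_injective (by simpa [rotationAngle] using h)
  rw [periodSquare, Measure.volume_eq_prod, ← setLIntegral_congr
    (Measure.set_prod_ae_eq (image_circleAngle_ae_eq α s hc.ne')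
    (image_rotationAngle_ae_eq β)),
    ← Measure.volume_eq_prod, lintegral_image_prodMap (measurableSet_one_add_mul_ne_zero s)
    MeasurableSet.univ (fun τ hτ => hasDerivAt_circleAngle α hτ)
    (fun σ _ => hasDerivAt_rotationAngle β σ) (injOn_circleAngle α s hc.ne') hinj]
  refine lintegral_congr fun z => ?_
  rw [abs_of_nonneg (by positivity)]

/-- The truncated integral of `|x - y|⁻⁴` in the rational coordinates around `x`. -/
theorem lintegral_torus_diff_ball {R : ℝ} (hR : 1 < R) (α β : ℝ) {ε : ℝ} (hε : 0 < ε) :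
    ∫⁻ y in torus R \ Metric.ball (torusPoint R α β) ε,
        ENNReal.ofReal (1 / ‖torusPoint R α β - y‖ ^ 4) ∂μHE[2]
      = ENNReal.ofReal (1 / (4 * (R + Real.cos α) ^ 2)) *
        ∫⁻ z in {z | chordFactor (Real.sin α) (Real.sin α ^ 2 + (R + Real.cos α) ^ 2) z
          ≤ 4 * (R + Real.cos α) ^ 2 / ε ^ 2 * chordForm R z}, ENNReal.ofReal (torusKernel R z) := by
  set x := torusPoint R α β with hx
  set s := Real.sin α with hs
  set c := R + Real.cos α with hc
  set k := s ^ 2 + c ^ 2 with hk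
  have hc0 : 0 < c := by linarith [Real.neg_one_le_cos α]
  have hball : MeasurableSet (Metric.ball x ε)ᶜ := Metric.isOpen_ball.measurableSet.compl
  have hMm : MeasurableSet {z : ℝ × ℝ | chordFactor s k z ≤ 4 * c ^ 2 / ε ^ 2 * chordForm R z} := by
    unfold chordFactor chordForm
    exact measurableSet_le (by fun_prop) (by fun_prop)
  have hfm : Measurable ((Metric.ball x ε)ᶜ.indicator fun y => ENNReal.ofReal (1 / ‖x - y‖ ^ 4)) :=
    Measurable.indicator (by fun_prop) hball
  have hSm : MeasurableSet ({τ | 1 + s * τ ≠ 0} ×ˢ univ : Set (ℝ × ℝ)) :=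
    (measurableSet_one_add_mul_ne_zero s).prod MeasurableSet.univ
  have hSae : ({τ | 1 + s * τ ≠ 0} ×ˢ univ : Set (ℝ × ℝ)) =ᵐ[volume] (univ : Set (ℝ × ℝ)) := by
    rw [← univ_prod_univ]
    exact Measure.set_prod_ae_eq (setOf_one_add_mul_ne_zero_ae_eq_univ s) (ae_eq_refl _)
  rw [sdiff_eq, inter_comm, ← Measure.restrict_restrict hball, ← lintegral_indicator hball,
    lintegral_torus hR α β hfm, lintegral_periodSquare α β s hc0,
    ← lintegral_const_mul' _ _ ENNReal.ofReal_ne_top, ← lintegral_indicator hMm]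
  conv_rhs => rw [← setLIntegral_univ, ← setLIntegral_congr hSae]
  refine setLIntegral_congr_fun hSm ?_
  rintro ⟨τ, σ⟩ ⟨hτ, -⟩
  have hτ : 1 + s * τ ≠ 0 := hτ
  have hd := dist_sq_circleAngle_rotationAngle R α β σ hτ
  have hdens := add_cos_circleAngle R α hτ
  rw [← hx, ← hs, ← hc, ← hk] at hd
  rw [← hs, ← hc] at hdens
  set N := (1 + s * τ) ^ 2 + c ^ 2 * τ ^ 2 with hN
  have hN0 : 0 < N := by positivity
  have hMN : chordFactor s k (τ, σ) = (1 + σ ^ 2) * N := by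
    simp only [chordFactor, hk, hN]
    ring
  have hM0 : 0 < chordFactor s k (τ, σ) := by rw [hMN]; positivity
  set y := torusPoint R (circleAngle α s c τ) (rotationAngle β σ) with hy
  have hmem : y ∈ (Metric.ball x ε)ᶜ ↔
      (τ, σ) ∈ {z : ℝ × ℝ | chordFactor s k z ≤ 4 * c ^ 2 / ε ^ 2 * chordForm R z} := by
    rw [mem_compl_iff, Metric.mem_ball, not_lt, dist_comm, ← abs_of_pos hε,
      ← abs_of_nonneg (dist_nonneg (x := x)),
      ← sq_le_sq, hd, le_div_iff₀ hM0, abs_of_pos hε]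
    rw [mem_ofPred_eq, div_mul_eq_mul_div, le_div_iff₀ (by positivity), mul_comm]
  show ENNReal.ofReal (2 * c / N * (2 / (1 + σ ^ 2))) * (ENNReal.ofReal (R + Real.cos (circleAngle α s c τ))
    * (Metric.ball x ε)ᶜ.indicator _ y) = _
  by_cases h : y ∈ (Metric.ball x ε)ᶜ
  · rw [indicator_of_mem h, indicator_of_mem (hmem.1 h), ← ENNReal.ofReal_mul' (by positivity),
      ← ENNReal.ofReal_mul (by positivity), ← ENNReal.ofReal_mul (by positivity)]
    congr 1
    have hd4 : ‖x - y‖ ^ 4 = (4 * c ^ 2 * chordForm R (τ, σ) / chordFactor s k (τ, σ)) ^ 2 := by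
      rw [← hd, dist_eq_norm]
      ring
    have hQ : chordForm R (τ, σ) ≠ 0 := by
      intro h0
      rw [h0, mul_zero, zero_div] at hd
      have h1 : dist x y = 0 := by simpa using hd
      rw [mem_compl_iff, Metric.mem_ball, not_lt, dist_comm, h1] at h
      linarith
    rw [hd4, hdens, hMN, torusKernel]
    field_simp
    ring
  · rw [indicator_of_notMem h, indicator_of_notMem (fun h' => h (hmem.2 h'))]
    simp

/-! ### The radial integral -/

/-- Twice the integral of the kernel in polar coordinates along the ray where
`((R ^ 2 - 1) cos ^ 2, sin ^ 2, R ^ 2 cos ^ 2 sin ^ 2) = (a, b, p)`, outside the radius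
`W ^ (-1/2)`. -/
def radialPrimitive (a b p W : ℝ) : ℝ :=
  W + (a + b - 2 * p) * Real.log (1 + W / p) + (a - p) * (b - p) * (W / (p * (W + p)))

/-- The kernel in polar coordinates, including the Jacobian `r`. -/
def radialKernel (a b p r : ℝ) : ℝ := (1 + a * r ^ 2) * (1 + b * r ^ 2) / (r ^ 3 * (1 + p * r ^ 2) ^ 2)

theorem hasDerivAt_radialPrimitive (a b : ℝ) {p r : ℝ} (hp : 0 < p) (hr : 0 < r) :
    HasDerivAt (fun r => -(1 / 2) * radialPrimitive a b p (r ^ 2)⁻¹) (radialKernel a b p r) r := by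
  have hw : HasDerivAt (fun r : ℝ => (r ^ 2)⁻¹) (-(2 * r) / (r ^ 2) ^ 2) r := by
    have := (hasDerivAt_pow 2 r).fun_inv (by positivity)
    simpa using this
  have hw0 : 0 < (r ^ 2)⁻¹ := by positivity
  have h1 : HasDerivAt (fun r : ℝ => Real.log (1 + (r ^ 2)⁻¹ / p))
      ((-(2 * r) / (r ^ 2) ^ 2 / p) / (1 + (r ^ 2)⁻¹ / p)) r :=
    ((hw.div_const p).const_add 1).log (by positivity)
  have h2 : HasDerivAt (fun r : ℝ => (r ^ 2)⁻¹ / (p * ((r ^ 2)⁻¹ + p)))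
      ((-(2 * r) / (r ^ 2) ^ 2 * (p * ((r ^ 2)⁻¹ + p)) - (r ^ 2)⁻¹ * (p * (-(2 * r) / (r ^ 2) ^ 2)))
        / (p * ((r ^ 2)⁻¹ + p)) ^ 2) r :=
    hw.div ((hw.add_const p).const_mul p) (by positivity)
  refine (((hw.add (h1.const_mul (a + b - 2 * p))).add
    (h2.const_mul ((a - p) * (b - p)))).const_mul (-(1 / 2))).congr_deriv ?_
  have e1 : 1 + (r ^ 2)⁻¹ / p = (1 + p * r ^ 2) / (p * r ^ 2) := by field_simp; ring
  have e2 : (r ^ 2)⁻¹ + p = (1 + p * r ^ 2) / r ^ 2 := by field_simp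
  have hD : 0 < 1 + p * r ^ 2 := by positivity
  rw [e1, e2, radialKernel]
  obtain ⟨D, hDe⟩ : ∃ D, D = 1 + p * r ^ 2 := ⟨_, rfl⟩
  rw [← hDe] at hD ⊢
  field_simp
  subst hDe
  ring

theorem tendsto_radialPrimitive (a b : ℝ) {p : ℝ} (hp : 0 < p) :
    Tendsto (fun r => -(1 / 2) * radialPrimitive a b p (r ^ 2)⁻¹) atTop (𝓝 0) := by
  have hw : Tendsto (fun r : ℝ => (r ^ 2)⁻¹) atTop (𝓝 0) :=
    tendsto_inv_atTop_zero.comp (tendsto_pow_atTop two_ne_zero)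
  have hc : ContinuousAt (fun w => -(1 / 2) * radialPrimitive a b p w) 0 := by
    unfold radialPrimitive
    have h1 : (1 : ℝ) + 0 / p ≠ 0 := by simp
    have h2 : p * (0 + p) ≠ 0 := by positivity
    fun_prop (disch := assumption)
  have := hc.tendsto.comp hw
  simpa [radialPrimitive, Function.comp_def] using this

theorem radialKernel_nonneg {a b p r : ℝ} (ha : 0 ≤ a) (hb : 0 ≤ b) (hr : 0 < r) :
    0 ≤ radialKernel a b p r := by
  unfold radialKernel
  positivity

theorem radialPrimitive_nonneg_and_lintegral {a b p W : ℝ} (ha : 0 ≤ a) (hb : 0 ≤ b) (hp : 0 < p)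
    (hW : 0 < W) :
    0 ≤ 1 / 2 * radialPrimitive a b p W ∧
      ∫⁻ r in Ioi (1 / √W), ENNReal.ofReal (radialKernel a b p r)
        = ENNReal.ofReal (1 / 2 * radialPrimitive a b p W) := by
  have hpos : 0 < 1 / √W := by positivity
  have hd : ∀ r ∈ Ici (1 / √W), HasDerivAt (fun r => -(1 / 2) * radialPrimitive a b p (r ^ 2)⁻¹)
      (radialKernel a b p r) r := fun r hr => hasDerivAt_radialPrimitive a b hp (hpos.trans_le hr)
  have hnn : ∀ r ∈ Ioi (1 / √W), 0 ≤ radialKernel a b p r := fun r hr =>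
    radialKernel_nonneg ha hb (hpos.trans hr)
  have hint := integrableOn_Ioi_deriv_of_nonneg' hd hnn (tendsto_radialPrimitive a b hp)
  have hval := integral_Ioi_of_hasDerivAt_of_nonneg' hd hnn (tendsto_radialPrimitive a b hp)
  have hend : ((1 / √W) ^ 2)⁻¹ = W := by
    rw [div_pow, Real.sq_sqrt hW.le]
    simp
  rw [hend] at hval
  have hval' : ∫ r in Ioi (1 / √W), radialKernel a b p r = 1 / 2 * radialPrimitive a b p W := by
    rw [hval]; ring
  have hae : 0 ≤ᵐ[volume.restrict (Ioi (1 / √W))] radialKernel a b p :=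
    (ae_restrict_iff' measurableSet_Ioi).2 (Eventually.of_forall hnn)
  refine ⟨hval' ▸ integral_nonneg_of_ae hae, ?_⟩
  rw [← hval', ofReal_integral_eq_lintegral_ofReal hint hae]

/-! ### The kernel in polar coordinates -/

/-- The coefficient `p` of the radial kernel in the direction `θ`. -/
def rayP (R θ : ℝ) : ℝ := R ^ 2 * Real.cos θ ^ 2 * Real.sin θ ^ 2

/-- The coefficient `a` of the radial kernel in the direction `θ`. -/
def rayA (R θ : ℝ) : ℝ := (R ^ 2 - 1) * Real.cos θ ^ 2

/-- The coefficient `b` of the radial kernel in the direction `θ`. -/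
def rayB (θ : ℝ) : ℝ := Real.sin θ ^ 2

theorem mul_torusKernel_polar (R θ : ℝ) {r : ℝ} (hr : 0 < r) :
    r * torusKernel R (r * Real.cos θ, r * Real.sin θ)
      = radialKernel (rayA R θ) (rayB θ) (rayP R θ) r := by
  have h : chordForm R (r * Real.cos θ, r * Real.sin θ) = r ^ 2 * (1 + rayP R θ * r ^ 2) := by
    simp only [chordForm, rayP]
    linear_combination r ^ 2 * Real.sin_sq_add_cos_sq θ
  have hp : 0 ≤ rayP R θ := by unfold rayP; positivity
  rw [torusKernel, h, radialKernel]
  simp only [rayA, rayB]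
  have hD : 0 < 1 + rayP R θ * r ^ 2 := by positivity
  generalize 1 + rayP R θ * r ^ 2 = D at hD
  field_simp

/-- The values of the radius for which the point in the direction `θ` lies outside the ball; `Λ`
is `4 (R + cos α) ^ 2 / ε ^ 2`. -/
def rayCutoff (R s k Λ θ : ℝ) : Set ℝ :=
  {r | 0 < r ∧ chordFactor s k (r * Real.cos θ, r * Real.sin θ)
    ≤ Λ * chordForm R (r * Real.cos θ, r * Real.sin θ)}

theorem lintegral_torusKernel_polar (R s k Λ : ℝ) :
    ∫⁻ z in {z | chordFactor s k z ≤ Λ * chordForm R z}, ENNReal.ofReal (torusKernel R z)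
      = ∫⁻ θ in Ioo (-Real.pi) Real.pi, ∫⁻ r in rayCutoff R s k Λ θ,
          ENNReal.ofReal (radialKernel (rayA R θ) (rayB θ) (rayP R θ) r) := by
  have hMm : MeasurableSet {z : ℝ × ℝ | chordFactor s k z ≤ Λ * chordForm R z} := by
    unfold chordFactor chordForm
    exact measurableSet_le (by fun_prop) (by fun_prop)
  have hkm : Measurable (torusKernel R) := by
    unfold torusKernel chordForm
    fun_prop
  have hfm : Measurable ({z : ℝ × ℝ | chordFactor s k z ≤ Λ * chordForm R z}.indicator
      fun z => ENNReal.ofReal (torusKernel R z)) := hkm.ennreal_ofReal.indicator hMm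
  have hsm : Measurable fun z : ℝ × ℝ => (polarCoord.symm z : ℝ × ℝ) := by
    simp only [polarCoord_symm_apply]
    fun_prop
  have hm : Measurable fun z : ℝ × ℝ => ENNReal.ofReal z.1 •
      {z : ℝ × ℝ | chordFactor s k z ≤ Λ * chordForm R z}.indicator
        (fun z => ENNReal.ofReal (torusKernel R z)) (polarCoord.symm z) :=
    (measurable_fst.ennreal_ofReal).smul (hfm.comp hsm)
  rw [← lintegral_indicator hMm, ← lintegral_comp_polarCoord_symm, polarCoord_target,
    Measure.volume_eq_prod, setLIntegral_prod_symm _ hm.aemeasurable]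
  refine lintegral_congr fun θ => ?_
  have hcm : MeasurableSet (rayCutoff R s k Λ θ) := by
    unfold rayCutoff chordFactor chordForm
    have h1 : Measurable fun r : ℝ => (1 + (r * Real.sin θ) ^ 2)
        * (1 + 2 * s * (r * Real.cos θ) + k * (r * Real.cos θ) ^ 2) := by fun_prop
    have h2 : Measurable fun r : ℝ => Λ * ((r * Real.cos θ) ^ 2 + (r * Real.sin θ) ^ 2
        + R ^ 2 * (r * Real.cos θ) ^ 2 * (r * Real.sin θ) ^ 2) := by fun_prop
    exact measurableSet_Ioi.inter (measurableSet_le h1 h2)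
  rw [← lintegral_indicator hcm, ← lintegral_indicator measurableSet_Ioi]
  refine lintegral_congr fun r => ?_
  by_cases hr : 0 < r
  · have hiff : (r * Real.cos θ, r * Real.sin θ) ∈
        {z : ℝ × ℝ | chordFactor s k z ≤ Λ * chordForm R z} ↔ r ∈ rayCutoff R s k Λ θ :=
      ⟨fun h => ⟨hr, h⟩, fun h => h.2⟩
    rw [indicator_of_mem (show r ∈ Ioi 0 from hr), polarCoord_symm_apply, smul_eq_mul]
    by_cases h : r ∈ rayCutoff R s k Λ θ
    · rw [indicator_of_mem h, indicator_of_mem (hiff.2 h), ← ENNReal.ofReal_mul hr.le,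
        mul_torusKernel_polar R θ hr]
    · rw [indicator_of_notMem h, indicator_of_notMem (fun h' => h (hiff.1 h')), mul_zero]
  · rw [indicator_of_notMem (show r ∉ Ioi 0 from hr), indicator_of_notMem (fun h => hr h.1)]

/-! ### The boundary of the excised disc -/

/-- The term of order zero in the equation of the excised disc. -/
def rayM (R k θ : ℝ) : ℝ := Real.sin θ ^ 2 + k * Real.cos θ ^ 2 - rayP R θ

/-- The inverse square of the radius at which the ray in the direction `θ` leaves the excised disc,
for `Λ = L ^ 2` and up to an error `η`: the solution `W = y ^ 2` of
`y ^ 2 + 2 s y cos θ + rayM = Λ + η`. -/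
def exitLevel (R s k L η θ : ℝ) : ℝ :=
  (-(s * Real.cos θ) + √(L ^ 2 - rayM R k θ + s ^ 2 * Real.cos θ ^ 2 + η)) ^ 2

theorem mem_rayCutoff_iff {R s k Λ θ y : ℝ} (hy : 0 < y) :
    1 / y ∈ rayCutoff R s k Λ θ ↔
      (y ^ 2 + Real.sin θ ^ 2) * (y ^ 2 + 2 * (s * Real.cos θ) * y + k * Real.cos θ ^ 2)
        ≤ Λ * (y ^ 2 + rayP R θ) := by
  have h1 : chordFactor s k (1 / y * Real.cos θ, 1 / y * Real.sin θ) = ((y ^ 2 + Real.sin θ ^ 2) *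
      (y ^ 2 + 2 * (s * Real.cos θ) * y + k * Real.cos θ ^ 2)) / y ^ 4 := by
    simp only [chordFactor]
    field_simp
  have h2 : chordForm R (1 / y * Real.cos θ, 1 / y * Real.sin θ) = (y ^ 2 + rayP R θ) / y ^ 4 := by
    simp only [chordForm, rayP]
    field_simp
    linear_combination y ^ 2 * Real.sin_sq_add_cos_sq θ
  have h3 : 0 < 1 / y := by positivity
  simp only [rayCutoff, mem_ofPred_eq, h1, h2, h3, true_and]
  rw [← mul_div_assoc, div_le_div_iff_of_pos_right (by positivity)]

/-- The constant in the estimate of the lower order terms of the equation of the excised disc. -/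
def remBound (R k : ℝ) : ℝ := 2 * (1 + R ^ 2) + k + R ^ 2 * (1 + k + R ^ 2)

/-- The lower bound for `L` above which the estimates of the excised disc hold. -/
def largeL (R k : ℝ) : ℝ := 8 * (2 + k) * (4 + k + R ^ 2 + remBound R k)

/-- The width of the error in the equation of the excised disc. -/
def errWidth (R k L : ℝ) : ℝ := 6 * (2 + k) * remBound R k / L

theorem rayP_nonneg (R θ : ℝ) : 0 ≤ rayP R θ := by unfold rayP; positivity

theorem rayP_le (R θ : ℝ) : rayP R θ ≤ R ^ 2 := by
  unfold rayP
  have h1 := Real.cos_sq_le_one θ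
  have h2 := Real.sin_sq_le_one θ
  have : Real.cos θ ^ 2 * Real.sin θ ^ 2 ≤ 1 := mul_le_one₀ h1 (sq_nonneg _) h2
  nlinarith [sq_nonneg R]

theorem abs_rayM_le {R k : ℝ} (hk : 0 ≤ k) (θ : ℝ) : |rayM R k θ| ≤ 1 + k + R ^ 2 := by
  have h1 := Real.cos_sq_le_one θ
  have h2 := Real.sin_sq_le_one θ
  have h3 := rayP_nonneg R θ
  have h4 := rayP_le R θ
  have h5 : k * Real.cos θ ^ 2 ≤ k := mul_le_of_le_one_right hk h1
  have h6 : 0 ≤ k * Real.cos θ ^ 2 := by positivity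
  have h7 := sq_nonneg (Real.sin θ)
  unfold rayM
  rw [abs_le]
  constructor <;> linarith [sq_nonneg R]

theorem remBound_pos {R k : ℝ} (hk : 0 ≤ k) : 0 < remBound R k := by unfold remBound; positivity

/-- The remainder of the division of the equation of the excised disc by `y ^ 2 + p`. -/
theorem exists_cutoff_eq {R s k : ℝ} (hs : |s| ≤ 1) (hk : 0 ≤ k) (θ y : ℝ) (hy : 1 ≤ y) :
    ∃ ρ : ℝ, |ρ| ≤ 2 * remBound R k * y ∧
      (y ^ 2 + Real.sin θ ^ 2) * (y ^ 2 + 2 * (s * Real.cos θ) * y + k * Real.cos θ ^ 2)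
        = (y ^ 2 + rayP R θ) * ((y + s * Real.cos θ) ^ 2 + rayM R k θ - s ^ 2 * Real.cos θ ^ 2)
          + ρ := by
  refine ⟨2 * (s * Real.cos θ) * (Real.sin θ ^ 2 - rayP R θ) * y
    + (k * (Real.cos θ ^ 2 * Real.sin θ ^ 2) - rayP R θ * rayM R k θ), ?_, by unfold rayM; ring⟩
  have h1 := Real.cos_sq_le_one θ
  have h2 := Real.sin_sq_le_one θ
  have h3 := rayP_nonneg R θ
  have h4 := rayP_le R θ
  have h5 : |s * Real.cos θ| ≤ 1 := by
    rw [abs_mul]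
    exact mul_le_one₀ hs (abs_nonneg _) (Real.abs_cos_le_one θ)
  have h6 : |Real.sin θ ^ 2 - rayP R θ| ≤ 1 + R ^ 2 := by
    rw [abs_le]
    constructor <;> linarith [sq_nonneg R, sq_nonneg (Real.sin θ)]
  have h7 : |2 * (s * Real.cos θ) * (Real.sin θ ^ 2 - rayP R θ) * y| ≤ 2 * 1 * (1 + R ^ 2) * y := by
    rw [abs_mul, abs_mul, abs_mul, abs_of_pos (by linarith : 0 < y), abs_of_pos (two_pos (α := ℝ))]
    gcongr
  have h8 : |k * (Real.cos θ ^ 2 * Real.sin θ ^ 2)| ≤ k := by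
    rw [abs_of_nonneg (by positivity)]
    exact mul_le_of_le_one_right hk (mul_le_one₀ h1 (sq_nonneg _) h2)
  have h9 : |rayP R θ * rayM R k θ| ≤ R ^ 2 * (1 + k + R ^ 2) := by
    rw [abs_mul, abs_of_nonneg h3]
    gcongr
    exact abs_rayM_le hk θ
  have h10 : 0 ≤ k + R ^ 2 * (1 + k + R ^ 2) := by positivity
  calc _ ≤ 2 * 1 * (1 + R ^ 2) * y + (k + R ^ 2 * (1 + k + R ^ 2)) :=
        (abs_add_le _ _).trans (add_le_add h7 ((abs_sub _ _).trans (add_le_add h8 h9)))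
    _ ≤ 2 * remBound R k * y := by
        unfold remBound
        nlinarith [sq_nonneg R]

/-- A crude bound for the equation of the excised disc, uniform in the direction. -/
theorem cutoff_le {R k s : ℝ} (hR : 1 < R) (hs : |s| ≤ 1) (hk : 0 ≤ k) (θ y : ℝ) :
    (y ^ 2 + Real.sin θ ^ 2) * (y ^ 2 + 2 * (s * Real.cos θ) * y + k * Real.cos θ ^ 2)
      ≤ (2 + k) * (1 + y ^ 2) * (y ^ 2 + rayP R θ) := by
  have hs2 : s ^ 2 ≤ 1 := by rw [← sq_abs]; exact pow_le_one₀ (abs_nonneg s) hs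
  have h1 : y ^ 2 + 2 * (s * Real.cos θ) * y + k * Real.cos θ ^ 2
      ≤ (2 + k) * (y ^ 2 + Real.cos θ ^ 2) := by
    have : s ^ 2 * Real.cos θ ^ 2 ≤ Real.cos θ ^ 2 := mul_le_of_le_one_left (sq_nonneg _) hs2
    nlinarith [sq_nonneg (y - s * Real.cos θ), sq_nonneg y, sq_nonneg (Real.cos θ),
      mul_nonneg hk (sq_nonneg y)]
  have h2 : Real.cos θ ^ 2 * Real.sin θ ^ 2 ≤ rayP R θ := by
    unfold rayP
    rw [mul_assoc]
    exact le_mul_of_one_le_left (by positivity) (one_le_pow₀ hR.le)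
  have h3 := rayP_nonneg R θ
  calc _ ≤ (y ^ 2 + Real.sin θ ^ 2) * ((2 + k) * (y ^ 2 + Real.cos θ ^ 2)) := by gcongr
    _ = (2 + k) * (y ^ 4 + y ^ 2 * (Real.sin θ ^ 2 + Real.cos θ ^ 2)
          + Real.cos θ ^ 2 * Real.sin θ ^ 2) := by ring
    _ ≤ (2 + k) * (y ^ 4 + y ^ 2 * 1 + rayP R θ) := by
        rw [Real.sin_sq_add_cos_sq]
        gcongr
    _ ≤ (2 + k) * ((1 + y ^ 2) * (y ^ 2 + rayP R θ)) := by
        gcongr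
        nlinarith [mul_nonneg h3 (sq_nonneg y)]
    _ = _ := by ring

theorem errWidth_nonneg_and_le_one {R k L : ℝ} (hk : 0 ≤ k) (hL : largeL R k ≤ L) :
    0 ≤ errWidth R k L ∧ errWidth R k L ≤ 1 := by
  have h1 : 0 < remBound R k := remBound_pos hk
  have h2 : 0 < largeL R k := by unfold largeL; positivity
  have h3 : 0 < L := h2.trans_le hL
  unfold errWidth
  refine ⟨by positivity, ?_⟩
  rw [div_le_one h3]
  refine le_trans ?_ hL
  unfold largeL
  have : 0 ≤ (2 + k) * (4 + k + R ^ 2) := by positivity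
  nlinarith [mul_pos (by linarith : 0 < 2 + k) h1]

/-- Bounds for the square root in the equation of the excised disc. -/
theorem sqrt_exit_bounds {R s k L η : ℝ} (hs : |s| ≤ 1) (hk : 0 ≤ k) (hL : largeL R k ≤ L)
    (hη : |η| ≤ 1) (θ : ℝ) :
    L / 2 + 1 ≤ √(L ^ 2 - rayM R k θ + s ^ 2 * Real.cos θ ^ 2 + η) ∧
      √(L ^ 2 - rayM R k θ + s ^ 2 * Real.cos θ ^ 2 + η) ≤ 2 * L ∧
      0 ≤ L ^ 2 - rayM R k θ + s ^ 2 * Real.cos θ ^ 2 + η := by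
  have h1 : 0 < remBound R k := remBound_pos hk
  have hL8 : 8 * (4 + k + R ^ 2) ≤ L := by
    refine le_trans ?_ hL
    unfold largeL
    have : 0 ≤ 4 + k + R ^ 2 := by positivity
    nlinarith [mul_nonneg hk this, mul_nonneg (by linarith : 0 ≤ 2 + k) h1.le]
  have hL0 : 32 ≤ L := by nlinarith [sq_nonneg R]
  have hm := abs_le.1 (abs_rayM_le (R := R) hk θ)
  have hsc : 0 ≤ s ^ 2 * Real.cos θ ^ 2 := by positivity
  have hsc1 : s ^ 2 * Real.cos θ ^ 2 ≤ 1 :=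
    mul_le_one₀ (by rw [← sq_abs]; exact pow_le_one₀ (abs_nonneg s) hs) (sq_nonneg _)
      (Real.cos_sq_le_one θ)
  have hη' := abs_le.1 hη
  have hlow : (L / 2 + 1) ^ 2 ≤ L ^ 2 - rayM R k θ + s ^ 2 * Real.cos θ ^ 2 + η := by nlinarith
  refine ⟨Real.le_sqrt_of_sq_le hlow, Real.sqrt_le_iff.2 ⟨by linarith, by nlinarith⟩,
    (sq_nonneg _).trans hlow⟩

theorem abs_mul_cos_le_one {s : ℝ} (hs : |s| ≤ 1) (θ : ℝ) : |s * Real.cos θ| ≤ 1 := by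
  rw [abs_mul]
  exact mul_le_one₀ hs (abs_nonneg _) (Real.abs_cos_le_one θ)

theorem exitLevel_pos {R s k L η : ℝ} (hs : |s| ≤ 1) (hk : 0 ≤ k) (hL : largeL R k ≤ L)
    (hη : |η| ≤ 1) (θ : ℝ) : 0 < exitLevel R s k L η θ := by
  have h1 := sqrt_exit_bounds hs hk hL hη θ
  have h2 := abs_le.1 (abs_mul_cos_le_one hs θ)
  have h3 : 0 < largeL R k := by
    have := remBound_pos (R := R) hk
    unfold largeL
    positivity
  unfold exitLevel
  have : 0 < -(s * Real.cos θ) + √(L ^ 2 - rayM R k θ + s ^ 2 * Real.cos θ ^ 2 + η) := by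
    linarith [h1.1]
  positivity

/-- The excised disc in the direction `θ` lies between two intervals whose endpoints are given
explicitly. -/
theorem rayCutoff_bounds {R s k L : ℝ} (hR : 1 < R) (hs : |s| ≤ 1) (hk : 0 ≤ k)
    (hL : largeL R k ≤ L) (θ : ℝ) :
    Ioi (1 / √(exitLevel R s k L (-errWidth R k L) θ)) ⊆ rayCutoff R s k (L ^ 2) θ ∧
      rayCutoff R s k (L ^ 2) θ ⊆ Ioi (1 / √(exitLevel R s k L (errWidth R k L) θ)) := by
  have hB : 0 < remBound R k := remBound_pos hk
  have hη := errWidth_nonneg_and_le_one hk hL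
  have hLpos : 0 < L := lt_of_lt_of_le (by unfold largeL; positivity) hL
  have hL8 : 8 * (2 + k) ≤ L := by
    refine le_trans ?_ hL
    unfold largeL
    have : 1 ≤ 4 + k + R ^ 2 + remBound R k := by nlinarith [sq_nonneg R]
    exact le_mul_of_one_le_right (by positivity) this
  have hsc := abs_le.1 (abs_mul_cos_le_one hs θ)
  have hp := rayP_nonneg R θ
  have hηL : errWidth R k L * L = 6 * (2 + k) * remBound R k := by
    unfold errWidth
    field_simp
  -- the error width dominates the remainder as soon as `L ≤ 2 (2 + k) y`
  have hdom : ∀ y, 0 < y → L ≤ 2 * (2 + k) * y →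
      2 * remBound R k * y < errWidth R k L * (y ^ 2 + rayP R θ) := by
    intro y hy hyL
    have h1 : errWidth R k L * L ≤ errWidth R k L * (2 * (2 + k) * y) := by gcongr; exact hη.1
    have h2 : 3 * remBound R k ≤ errWidth R k L * y := by
      rw [hηL] at h1
      have : (2 * (2 + k)) * (3 * remBound R k) ≤ (2 * (2 + k)) * (errWidth R k L * y) := by linarith
      exact le_of_mul_le_mul_left this (by positivity)
    have h3 : 3 * remBound R k * y ≤ errWidth R k L * y * y := by gcongr
    nlinarith [mul_nonneg hη.1 hp, mul_pos hB hy]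
  constructor
  · intro r hr
    obtain ⟨hy1, -, hy3⟩ := sqrt_exit_bounds (R := R) (η := -errWidth R k L) hs hk hL
      (by rw [abs_neg, abs_of_nonneg hη.1]; exact hη.2) θ
    have hW := exitLevel_pos (R := R) (η := -errWidth R k L) hs hk hL
      (by rw [abs_neg, abs_of_nonneg hη.1]; exact hη.2) θ
    set D := L ^ 2 - rayM R k θ + s ^ 2 * Real.cos θ ^ 2 + -errWidth R k L with hD
    have hsq : √(exitLevel R s k L (-errWidth R k L) θ) = -(s * Real.cos θ) + √D := by
      rw [exitLevel, ← hD, Real.sqrt_sq (by linarith)]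
    have hr0 : 0 < r := lt_trans (by positivity) hr
    have hry : 1 / r < -(s * Real.cos θ) + √D := by
      rw [← hsq]
      exact (div_lt_comm₀ hr0 (by positivity)).2 hr
    have hy : 0 < 1 / r := by positivity
    rw [← one_div_one_div r, mem_rayCutoff_iff hy]
    set y := 1 / r
    -- for small `y` the expansion is useless, but the crude bound `cutoff_le` suffices
    by_cases hyL : L ≤ 2 * (2 + k) * y
    · have hy1' : 1 ≤ y := by nlinarith
      obtain ⟨ρ, hρ, heq⟩ := exists_cutoff_eq (R := R) hs hk θ y hy1'
      rw [heq]
      have h2 : (y + s * Real.cos θ) ^ 2 ≤ D := by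
        rw [← Real.sq_sqrt hy3]
        exact pow_le_pow_left₀ (by linarith) (by linarith) 2
      have h3 := hdom y hy hyL
      have h4 : (y ^ 2 + rayP R θ) * ((y + s * Real.cos θ) ^ 2 + rayM R k θ - s ^ 2 * Real.cos θ ^ 2)
          ≤ (y ^ 2 + rayP R θ) * (L ^ 2 - errWidth R k L) :=
        mul_le_mul_of_nonneg_left (by linarith) (by positivity)
      linarith [(abs_le.1 hρ).2]
    · refine (cutoff_le hR hs hk θ y).trans ?_
      have h1 : 2 * (2 + k) * y < L := not_le.1 hyL
      have h2 : (2 * (2 + k) * y) ^ 2 ≤ L ^ 2 := pow_le_pow_left₀ (by positivity) h1.le 2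
      have h3 : (2 + k) * (1 + y ^ 2) ≤ L ^ 2 := by
        have h4 : 8 * (2 + k) * L ≤ L ^ 2 := by nlinarith
        have h5 : 8 * (2 + k) ≤ 8 * (2 + k) * L := by
          refine le_mul_of_one_le_right (by positivity) ?_
          linarith
        nlinarith [sq_nonneg y, mul_nonneg hk (sq_nonneg y)]
      gcongr
  · intro r hr
    have hr0 : 0 < r := hr.1
    obtain ⟨hy1, -, hy3⟩ := sqrt_exit_bounds (R := R) (η := errWidth R k L) hs hk hL
      (by rw [abs_of_nonneg hη.1]; exact hη.2) θ
    have hW := exitLevel_pos (R := R) (η := errWidth R k L) hs hk hL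
      (by rw [abs_of_nonneg hη.1]; exact hη.2) θ
    set D := L ^ 2 - rayM R k θ + s ^ 2 * Real.cos θ ^ 2 + errWidth R k L with hD
    have hsq : √(exitLevel R s k L (errWidth R k L) θ) = -(s * Real.cos θ) + √D := by
      rw [exitLevel, ← hD, Real.sqrt_sq (by linarith)]
    have hy : 0 < 1 / r := by positivity
    rw [← one_div_one_div r, mem_rayCutoff_iff hy] at hr
    by_contra hcon
    have hcon : r ≤ 1 / √(exitLevel R s k L (errWidth R k L) θ) := not_lt.1 hcon
    have hry : -(s * Real.cos θ) + √D ≤ 1 / r := by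
      rw [← hsq]
      exact (le_div_comm₀ (by positivity) hr0).2 hcon
    set y := 1 / r
    have hyL : L / 2 ≤ y := by linarith
    have hy1' : 1 ≤ y := by linarith
    obtain ⟨ρ, hρ, heq⟩ := exists_cutoff_eq (R := R) hs hk θ y hy1'
    rw [heq] at hr
    have h2 : D ≤ (y + s * Real.cos θ) ^ 2 := by
      rw [← Real.sq_sqrt hy3]
      exact pow_le_pow_left₀ (Real.sqrt_nonneg _) (by linarith) 2
    have h3 := hdom y hy (by nlinarith)
    have h4 : (y ^ 2 + rayP R θ) * (L ^ 2 + errWidth R k L) ≤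
        (y ^ 2 + rayP R θ) * ((y + s * Real.cos θ) ^ 2 + rayM R k θ - s ^ 2 * Real.cos θ ^ 2) := by
      gcongr
      linarith
    linarith [(abs_le.1 hρ).1]

/-! ### Trigonometric and logarithmic integrals -/

theorem integral_cos_sq_period : ∫ θ in -Real.pi..Real.pi, Real.cos θ ^ 2 = Real.pi := by
  rw [integral_cos_sq]
  simp

theorem integral_sin_sq_period : ∫ θ in -Real.pi..Real.pi, Real.sin θ ^ 2 = Real.pi := by
  rw [integral_sin_sq]
  simp

theorem integral_cos_two_mul_sq_period :
    ∫ θ in -Real.pi..Real.pi, Real.cos (2 * θ) ^ 2 = Real.pi := by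
  rw [intervalIntegral.integral_comp_mul_left (fun x => Real.cos x ^ 2) two_ne_zero, integral_cos_sq]
  have h1 : Real.sin (2 * Real.pi) = 0 := Real.sin_two_pi
  have h2 : Real.sin (2 * -Real.pi) = 0 := by rw [mul_neg, Real.sin_neg, h1, neg_zero]
  rw [h1, h2]
  simp

theorem integral_cos_two_mul_period : ∫ θ in -Real.pi..Real.pi, Real.cos (2 * θ) = 0 := by
  rw [intervalIntegral.integral_comp_mul_left Real.cos two_ne_zero, integral_cos]
  have h1 : Real.sin (2 * Real.pi) = 0 := Real.sin_two_pi
  have h2 : Real.sin (2 * -Real.pi) = 0 := by rw [mul_neg, Real.sin_neg, h1, neg_zero]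
  rw [h1, h2]
  simp

theorem intervalIntegrable_log_sin_two_mul :
    IntervalIntegrable (fun θ => Real.log (Real.sin (2 * θ))) volume (-Real.pi) Real.pi := by
  have h : IntervalIntegrable (fun x => Real.log (Real.sin x)) volume (2 * -Real.pi) (2 * Real.pi) :=
    intervalIntegrable_log_sin
  have h' := h.comp_mul_left (c := 2)
  rwa [mul_div_cancel_left₀ _ two_ne_zero, mul_div_cancel_left₀ _ two_ne_zero] at h'

theorem integral_log_sin_two_mul :
    ∫ θ in -Real.pi..Real.pi, Real.log (Real.sin (2 * θ)) = -(2 * Real.pi * Real.log 2) := by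
  have hper : Function.Periodic (fun x => Real.log (Real.sin x)) Real.pi := fun x => by
    simp only [Real.sin_add_pi, Real.log_neg_eq_log]
  have h := hper.intervalIntegral_add_zsmul_eq 4 (2 * -Real.pi) (fun _ _ => intervalIntegrable_log_sin)
  have h4 : 2 * -Real.pi + (4 : ℤ) • Real.pi = 2 * Real.pi := by simp; ring
  rw [h4, hper.intervalIntegral_add_eq _ 0, zero_add, integral_log_sin_zero_pi] at h
  rw [intervalIntegral.integral_comp_mul_left (fun x => Real.log (Real.sin x)) two_ne_zero, h]
  simp
  ring

/-- The logarithm of `rayP`, where it does not vanish. -/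
def logRayP (R θ : ℝ) : ℝ := 2 * Real.log (R / 2) + 2 * Real.log (Real.sin (2 * θ))

theorem rayP_eq (R θ : ℝ) : rayP R θ = (R / 2 * Real.sin (2 * θ)) ^ 2 := by
  rw [rayP, Real.sin_two_mul]
  ring

theorem rayP_pos {R θ : ℝ} (hR : 1 < R) (hθ : Real.sin (2 * θ) ≠ 0) : 0 < rayP R θ := by
  rw [rayP_eq]
  positivity

theorem log_rayP {R θ : ℝ} (hR : 1 < R) (hθ : Real.sin (2 * θ) ≠ 0) :
    Real.log (rayP R θ) = logRayP R θ := by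
  rw [rayP_eq, Real.log_pow, Real.log_mul (by positivity) hθ, logRayP]
  push_cast
  ring

theorem countable_setOf_sin_two_mul_eq_zero : {θ : ℝ | Real.sin (2 * θ) = 0}.Countable := by
  refine (countable_range fun n : ℤ => n * Real.pi / 2).mono fun θ hθ => ?_
  obtain ⟨n, hn⟩ := Real.sin_eq_zero_iff.1 hθ
  exact ⟨n, by simp only; linarith⟩

theorem ae_sin_two_mul_ne_zero : ∀ᵐ θ : ℝ, Real.sin (2 * θ) ≠ 0 :=
  countable_setOf_sin_two_mul_eq_zero.ae_notMem volume

theorem intervalIntegrable_logRayP (R : ℝ) :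
    IntervalIntegrable (logRayP R) volume (-Real.pi) Real.pi :=
  intervalIntegrable_const.add (intervalIntegrable_log_sin_two_mul.const_mul 2)

theorem integral_logRayP {R : ℝ} (hR : 1 < R) :
    ∫ θ in -Real.pi..Real.pi, logRayP R θ = 4 * Real.pi * Real.log R - 8 * Real.pi * Real.log 2 := by
  unfold logRayP
  rw [intervalIntegral.integral_add intervalIntegrable_const
    (intervalIntegrable_log_sin_two_mul.const_mul 2),
    intervalIntegral.integral_const_mul 2 fun θ => Real.log (Real.sin (2 * θ)),
    integral_log_sin_two_mul, intervalIntegral.integral_const,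
    Real.log_div (by positivity) two_ne_zero, smul_eq_mul]
  ring

theorem hasDerivAt_logRayP (R : ℝ) {θ : ℝ} (hθ : Real.sin (2 * θ) ≠ 0) :
    HasDerivAt (logRayP R) (2 * (Real.cos (2 * θ) * 2 / Real.sin (2 * θ))) θ := by
  have h : HasDerivAt (fun θ : ℝ => Real.sin (2 * θ)) (Real.cos (2 * θ) * 2) θ := by
    simpa using ((hasDerivAt_id θ).const_mul 2).sin
  exact ((h.log hθ).const_mul 2).const_add _

theorem continuous_sin_two_mul_mul_logRayP (R : ℝ) :
    Continuous fun θ => Real.sin (2 * θ) * logRayP R θ := by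
  have h : (fun θ => Real.sin (2 * θ) * logRayP R θ) = fun θ => 2 * Real.log (R / 2) * Real.sin (2 * θ)
      + 2 * (Real.sin (2 * θ) * Real.log (Real.sin (2 * θ))) := by
    ext θ
    unfold logRayP
    ring
  rw [h]
  have := Real.continuous_mul_log.comp (by fun_prop : Continuous fun θ : ℝ => Real.sin (2 * θ))
  exact (by fun_prop : Continuous _).add (this.const_mul 2)

theorem intervalIntegrable_mul_logRayP (R : ℝ) {f : ℝ → ℝ} (hf : Continuous f) :
    IntervalIntegrable (fun θ => f θ * logRayP R θ) volume (-Real.pi) Real.pi :=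
  (intervalIntegrable_logRayP R).continuousOn_mul hf.continuousOn

/-- Integration by parts against `sin 2θ`. -/
theorem integral_cos_two_mul_mul_logRayP (R : ℝ) :
    ∫ θ in -Real.pi..Real.pi, Real.cos (2 * θ) * logRayP R θ = 0 := by
  have hi := intervalIntegrable_mul_logRayP R (by fun_prop : Continuous fun θ : ℝ => Real.cos (2 * θ))
  have hc : IntervalIntegrable (fun θ : ℝ => Real.cos (2 * θ)) volume (-Real.pi) Real.pi :=
    Continuous.intervalIntegrable (by fun_prop) _ _
  have h := integral_eq_of_hasDerivAt_off_countable (fun θ => Real.sin (2 * θ) * logRayP R θ)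
    (fun θ => 2 * (Real.cos (2 * θ) * logRayP R θ) + 4 * Real.cos (2 * θ)) (a := -Real.pi) (b := Real.pi)
    countable_setOf_sin_two_mul_eq_zero (continuous_sin_two_mul_mul_logRayP R).continuousOn
    (fun θ hθ => by
      have hθ0 : Real.sin (2 * θ) ≠ 0 := hθ.2
      have h1 : HasDerivAt (fun θ : ℝ => Real.sin (2 * θ)) (Real.cos (2 * θ) * 2) θ := by
        simpa using ((hasDerivAt_id θ).const_mul 2).sin
      refine (h1.mul (hasDerivAt_logRayP R hθ0)).congr_deriv ?_
      field_simp
      ring)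
    ((hi.const_mul 2).add (hc.const_mul 4))
  rw [intervalIntegral.integral_add (hi.const_mul 2) (hc.const_mul 4),
    intervalIntegral.integral_const_mul, intervalIntegral.integral_const_mul,
    integral_cos_two_mul_period] at h
  have h1 : Real.sin (2 * Real.pi) = 0 := Real.sin_two_pi
  have h2 : Real.sin (2 * -Real.pi) = 0 := by rw [mul_neg, Real.sin_neg, h1, neg_zero]
  rw [h1, h2] at h
  linarith

/-- Integration by parts against `sin 2θ cos 2θ`. -/
theorem integral_cos_two_mul_sq_mul_logRayP {R : ℝ} (hR : 1 < R) :
    ∫ θ in -Real.pi..Real.pi, Real.cos (2 * θ) ^ 2 * logRayP R θ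
      = 2 * Real.pi * Real.log R - 4 * Real.pi * Real.log 2 - Real.pi := by
  have hi := intervalIntegrable_mul_logRayP R
    (by fun_prop : Continuous fun θ : ℝ => Real.cos (2 * θ) ^ 2)
  have hl := intervalIntegrable_logRayP R
  have hc : IntervalIntegrable (fun θ : ℝ => Real.cos (2 * θ) ^ 2) volume (-Real.pi) Real.pi :=
    Continuous.intervalIntegrable (by fun_prop) _ _
  have h := integral_eq_of_hasDerivAt_off_countable
    (fun θ => Real.sin (2 * θ) * logRayP R θ * Real.cos (2 * θ))
    (fun θ => 4 * (Real.cos (2 * θ) ^ 2 * logRayP R θ) + (-2) * logRayP R θ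
      + 4 * Real.cos (2 * θ) ^ 2) (a := -Real.pi) (b := Real.pi)
    countable_setOf_sin_two_mul_eq_zero
    ((continuous_sin_two_mul_mul_logRayP R).mul (by fun_prop)).continuousOn
    (fun θ hθ => by
      have hθ0 : Real.sin (2 * θ) ≠ 0 := hθ.2
      have h1 : HasDerivAt (fun θ : ℝ => Real.sin (2 * θ)) (Real.cos (2 * θ) * 2) θ := by
        simpa using ((hasDerivAt_id θ).const_mul 2).sin
      have h2 : HasDerivAt (fun θ : ℝ => Real.cos (2 * θ)) (-Real.sin (2 * θ) * 2) θ := by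
        simpa using ((hasDerivAt_id θ).const_mul 2).cos
      refine ((h1.mul (hasDerivAt_logRayP R hθ0)).mul h2).congr_deriv ?_
      have h3 := Real.sin_sq_add_cos_sq (2 * θ)
      simp only [Pi.mul_apply]
      field_simp
      linear_combination (-2 * logRayP R θ) * h3)
    (((hi.const_mul 4).add (hl.const_mul (-2))).add (hc.const_mul 4))
  rw [intervalIntegral.integral_add ((hi.const_mul 4).add (hl.const_mul (-2))) (hc.const_mul 4),
    intervalIntegral.integral_add (hi.const_mul 4) (hl.const_mul (-2)),
    intervalIntegral.integral_const_mul, intervalIntegral.integral_const_mul,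
    intervalIntegral.integral_const_mul, integral_cos_two_mul_sq_period, integral_logRayP hR] at h
  have h1 : Real.sin (2 * Real.pi) = 0 := Real.sin_two_pi
  have h2 : Real.sin (2 * -Real.pi) = 0 := by rw [mul_neg, Real.sin_neg, h1, neg_zero]
  rw [h1, h2] at h
  linarith

/-- The coefficient of the logarithm in the radial integral. -/
def rayG (R θ : ℝ) : ℝ := rayA R θ + rayB θ - 2 * rayP R θ

theorem rayG_eq (R θ : ℝ) :
    rayG R θ = (R ^ 2 - 2) / 2 * Real.cos (2 * θ) + R ^ 2 / 2 * Real.cos (2 * θ) ^ 2 := by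
  have h := Real.sin_sq_add_cos_sq θ
  have h2 : Real.sin θ ^ 2 = 1 - Real.cos θ ^ 2 := by linarith
  simp only [rayG, rayA, rayB, rayP, Real.cos_two_mul, h2]
  ring

theorem continuous_rayG (R : ℝ) : Continuous (rayG R) := by
  unfold rayG rayA rayB rayP
  fun_prop

theorem continuous_rayP (R : ℝ) : Continuous (rayP R) := by
  unfold rayP
  fun_prop

theorem integral_rayG (R : ℝ) : ∫ θ in -Real.pi..Real.pi, rayG R θ = Real.pi * R ^ 2 / 2 := by
  simp only [rayG_eq]
  rw [intervalIntegral.integral_add (Continuous.intervalIntegrable (by fun_prop) _ _)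
    (Continuous.intervalIntegrable (by fun_prop) _ _), intervalIntegral.integral_const_mul,
    intervalIntegral.integral_const_mul, integral_cos_two_mul_period,
    integral_cos_two_mul_sq_period]
  ring

theorem integral_rayP (R : ℝ) : ∫ θ in -Real.pi..Real.pi, rayP R θ = Real.pi * R ^ 2 / 4 := by
  have h : ∀ θ, rayP R θ = R ^ 2 / 4 - R ^ 2 / 4 * Real.cos (2 * θ) ^ 2 := fun θ => by
    rw [rayP_eq, mul_pow, Real.sin_sq]
    ring
  simp only [h]
  rw [intervalIntegral.integral_sub (Continuous.intervalIntegrable (by fun_prop) _ _)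
    (Continuous.intervalIntegrable (by fun_prop) _ _), intervalIntegral.integral_const_mul,
    integral_cos_two_mul_sq_period, intervalIntegral.integral_const, smul_eq_mul]
  ring

theorem integral_rayG_mul_logRayP {R : ℝ} (hR : 1 < R) :
    ∫ θ in -Real.pi..Real.pi, rayG R θ * logRayP R θ
      = Real.pi * R ^ 2 * Real.log R - 2 * Real.pi * R ^ 2 * Real.log 2 - Real.pi * R ^ 2 / 2 := by
  have h : ∀ θ, rayG R θ * logRayP R θ = (R ^ 2 - 2) / 2 * (Real.cos (2 * θ) * logRayP R θ)
      + R ^ 2 / 2 * (Real.cos (2 * θ) ^ 2 * logRayP R θ) := fun θ => by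
    rw [rayG_eq]
    ring
  simp only [h]
  rw [intervalIntegral.integral_add
    ((intervalIntegrable_mul_logRayP R (by fun_prop)).const_mul _)
    ((intervalIntegrable_mul_logRayP R (by fun_prop)).const_mul _),
    intervalIntegral.integral_const_mul, intervalIntegral.integral_const_mul,
    integral_cos_two_mul_mul_logRayP, integral_cos_two_mul_sq_mul_logRayP hR]
  ring

/-! ### Asymptotics of the truncated integral -/

theorem continuous_rayM (R k : ℝ) : Continuous (rayM R k) := by
  unfold rayM rayP
  fun_prop

theorem continuous_exitLevel (R s k L η : ℝ) : Continuous (exitLevel R s k L η) := by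
  have := continuous_rayM R k
  unfold exitLevel
  fun_prop

theorem integral_rayM (R k : ℝ) :
    ∫ θ in -Real.pi..Real.pi, rayM R k θ = Real.pi + k * Real.pi - Real.pi * R ^ 2 / 4 := by
  have hP := (continuous_rayP R).intervalIntegrable (μ := volume) (-Real.pi) Real.pi
  unfold rayM
  rw [intervalIntegral.integral_sub (Continuous.intervalIntegrable (by fun_prop) _ _) hP,
    intervalIntegral.integral_add (Continuous.intervalIntegrable (by fun_prop) _ _)
      (Continuous.intervalIntegrable (by fun_prop) _ _), intervalIntegral.integral_const_mul,
    integral_sin_sq_period, integral_cos_sq_period, integral_rayP]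

/-- A continuous function that changes sign under the shift by `π` has mean zero; this is why the
term of odd order in the radius of the excised disc does not contribute. -/
theorem integral_eq_zero_of_antiperiodic {f : ℝ → ℝ} (hf : Continuous f)
    (h : ∀ x, f (x + Real.pi) = -f x) : ∫ θ in -Real.pi..Real.pi, f θ = 0 := by
  have h1 := intervalIntegral.integral_comp_add_right f Real.pi (a := -Real.pi) (b := 0)
  simp only [h, intervalIntegral.integral_neg, neg_add_cancel, zero_add] at h1
  rw [← intervalIntegral.integral_add_adjacent_intervals (hf.intervalIntegrable (-Real.pi) 0)
    (hf.intervalIntegrable 0 Real.pi), ← h1]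
  ring

theorem exitLevel_eq {R s k L η : ℝ} (hs : |s| ≤ 1) (hk : 0 ≤ k) (hL : largeL R k ≤ L)
    (hη : |η| ≤ 1) (θ : ℝ) :
    exitLevel R s k L η θ = L ^ 2 + η - rayM R k θ + 2 * s ^ 2 * Real.cos θ ^ 2
      - 2 * s * (Real.cos θ * √(L ^ 2 - rayM R k θ + s ^ 2 * Real.cos θ ^ 2 + η)) := by
  have h := Real.sq_sqrt (sqrt_exit_bounds (R := R) hs hk hL hη θ).2.2
  unfold exitLevel
  linear_combination h

theorem integral_exitLevel {R s k L η : ℝ} (hs : |s| ≤ 1) (hk : 0 ≤ k) (hL : largeL R k ≤ L)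
    (hη : |η| ≤ 1) :
    ∫ θ in -Real.pi..Real.pi, exitLevel R s k L η θ = 2 * Real.pi * L ^ 2 + 2 * Real.pi * η
      + 2 * Real.pi * s ^ 2 - Real.pi - k * Real.pi + Real.pi * R ^ 2 / 4 := by
  have hM := continuous_rayM R k
  have hodd : ∫ θ in -Real.pi..Real.pi,
      Real.cos θ * √(L ^ 2 - rayM R k θ + s ^ 2 * Real.cos θ ^ 2 + η) = 0 := by
    refine integral_eq_zero_of_antiperiodic (by fun_prop) fun θ => ?_
    simp only [rayM, rayP, Real.cos_add_pi, Real.sin_add_pi, neg_sq, neg_mul]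
  simp only [exitLevel_eq hs hk hL hη]
  rw [intervalIntegral.integral_sub (Continuous.intervalIntegrable (by fun_prop) _ _)
    (Continuous.intervalIntegrable (by fun_prop) _ _), intervalIntegral.integral_const_mul, hodd,
    intervalIntegral.integral_add (Continuous.intervalIntegrable (by fun_prop) _ _)
    (Continuous.intervalIntegrable (by fun_prop) _ _), intervalIntegral.integral_const_mul,
    intervalIntegral.integral_sub (Continuous.intervalIntegrable (by fun_prop) _ _)
    (Continuous.intervalIntegrable (by fun_prop) _ _), intervalIntegral.integral_const,
    integral_rayM, integral_cos_sq_period, smul_eq_mul]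
  ring

/-- The asymptotic expansion, up to `O(1 / L)`, of the primitive at the boundary of the excised
disc. -/
def rayExpansion (R s k L η θ : ℝ) : ℝ :=
  exitLevel R s k L η θ + rayG R θ * (2 * Real.log L) - rayG R θ * logRayP R θ
    + ((R ^ 2 - 1) / R ^ 2 - rayG R θ - rayP R θ)

/-- The finite part of the integral of the kernel. -/
def finitePart (R s k : ℝ) : ℝ :=
  Real.pi * s ^ 2 + Real.pi / 2 - Real.pi * k / 2 - Real.pi * R ^ 2 * Real.log R / 2
    + Real.pi * R ^ 2 * Real.log 2 - Real.pi / R ^ 2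

theorem intervalIntegrable_rayExpansion (R s k L η : ℝ) :
    IntervalIntegrable (rayExpansion R s k L η) volume (-Real.pi) Real.pi := by
  have h1 := continuous_exitLevel R s k L η
  have h2 := continuous_rayG R
  have h3 := continuous_rayP R
  exact ((Continuous.intervalIntegrable (by fun_prop) _ _).sub
    (intervalIntegrable_mul_logRayP R h2)).add (Continuous.intervalIntegrable (by fun_prop) _ _)

theorem integral_rayExpansion {R s k L η : ℝ} (hR : 1 < R) (hs : |s| ≤ 1) (hk : 0 ≤ k)
    (hL : largeL R k ≤ L) (hη : |η| ≤ 1) :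
    ∫ θ in -Real.pi..Real.pi, rayExpansion R s k L η θ = 2 * Real.pi * L ^ 2 + 2 * Real.pi * η
      + Real.pi * R ^ 2 * Real.log L + 2 * finitePart R s k := by
  have h1 := continuous_exitLevel R s k L η
  have h2 := continuous_rayG R
  have h3 := continuous_rayP R
  unfold rayExpansion
  rw [intervalIntegral.integral_add ((Continuous.intervalIntegrable (by fun_prop) _ _).sub
    (intervalIntegrable_mul_logRayP R h2)) (Continuous.intervalIntegrable (by fun_prop) _ _),
    intervalIntegral.integral_sub (Continuous.intervalIntegrable (by fun_prop) _ _)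
    (intervalIntegrable_mul_logRayP R h2), integral_rayG_mul_logRayP hR,
    intervalIntegral.integral_add (Continuous.intervalIntegrable (by fun_prop) _ _)
    (Continuous.intervalIntegrable (by fun_prop) _ _), integral_exitLevel hs hk hL hη,
    intervalIntegral.integral_mul_const, integral_rayG,
    intervalIntegral.integral_sub (Continuous.intervalIntegrable (by fun_prop) _ _)
    (Continuous.intervalIntegrable (by fun_prop) _ _),
    intervalIntegral.integral_sub (Continuous.intervalIntegrable (by fun_prop) _ _)
    (Continuous.intervalIntegrable (by fun_prop) _ _), integral_rayG, integral_rayP,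
    intervalIntegral.integral_const, smul_eq_mul, finitePart]
  field_simp
  ring

theorem abs_log_le_two_mul {x : ℝ} (hx : |x - 1| ≤ 1 / 2) : |Real.log x| ≤ 2 * |x - 1| := by
  have hx' := abs_le.1 hx
  have hx0 : 0 < x := by linarith
  have h1 := Real.log_le_sub_one_of_pos hx0
  have h2 := Real.one_sub_inv_le_log_of_pos hx0
  have h3 : -(2 * |x - 1|) ≤ 1 - x⁻¹ := by
    have : 1 - x⁻¹ = (x - 1) / x := by field_simp
    rw [this, le_div_iff₀ hx0]
    nlinarith [neg_abs_le (x - 1), abs_nonneg (x - 1)]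
  rw [abs_le]
  exact ⟨by linarith, by linarith [le_abs_self (x - 1), abs_nonneg (x - 1)]⟩

theorem abs_rayG_le {R : ℝ} (hR : 1 < R) (θ : ℝ) : |rayG R θ| ≤ R ^ 2 + 1 := by
  have h1 := abs_le.1 (Real.abs_cos_le_one (2 * θ))
  have h2 := Real.cos_sq_le_one (2 * θ)
  have h3 := sq_nonneg (Real.cos (2 * θ))
  have hR2 : 1 < R ^ 2 := one_lt_pow₀ hR two_ne_zero
  rw [rayG_eq, abs_le]
  constructor <;> nlinarith

/-- The constant in the error of the expansion along a ray. -/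
def expansionBound (R k : ℝ) : ℝ := 2 * (R ^ 2 + 1) * (8 + k + 2 * R ^ 2) + 2 * (R ^ 2 * R ^ 2)

theorem abs_radialPrimitive_sub_le {R s k L η θ : ℝ} (hR : 1 < R) (hs : |s| ≤ 1) (hk : 0 ≤ k)
    (hL : largeL R k ≤ L) (hη : |η| ≤ 1) (hθ : Real.sin (2 * θ) ≠ 0) :
    |radialPrimitive (rayA R θ) (rayB θ) (rayP R θ) (exitLevel R s k L η θ)
      - rayExpansion R s k L η θ| ≤ expansionBound R k / L := by
  have hp := rayP_pos hR hθ
  have hW := exitLevel_pos (R := R) hs hk hL hη θ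
  have hR2 : 1 < R ^ 2 := one_lt_pow₀ hR two_ne_zero
  have hL8 : 2 * (8 + k + 2 * R ^ 2) ≤ L := by
    refine le_trans ?_ hL
    have h1 := remBound_pos (R := R) hk
    unfold largeL
    nlinarith [mul_nonneg hk (by positivity : 0 ≤ 4 + k + R ^ 2 + remBound R k)]
  have hL0 : 0 < L := by nlinarith
  have hL1 : 1 ≤ L := by nlinarith
  have hWL : |exitLevel R s k L η θ + rayP R θ - L ^ 2| ≤ (8 + k + 2 * R ^ 2) * L := by
    rw [exitLevel_eq hs hk hL hη]
    obtain ⟨hq1, hq2, -⟩ := sqrt_exit_bounds (R := R) hs hk hL hη θ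
    set q := √(L ^ 2 - rayM R k θ + s ^ 2 * Real.cos θ ^ 2 + η)
    have hx := abs_mul_cos_le_one hs θ
    have hxq : |s * Real.cos θ * q| ≤ 1 * (2 * L) := by
      rw [abs_mul, abs_of_nonneg (by linarith : 0 ≤ q)]
      gcongr
    have hx2 : (s * Real.cos θ) ^ 2 ≤ 1 := by
      rw [← sq_abs]
      exact pow_le_one₀ (abs_nonneg _) hx
    have hm := abs_le.1 (abs_rayM_le (R := R) hk θ)
    have hη' := abs_le.1 hη
    have hxq' := abs_le.1 hxq
    have hp1 := rayP_le R θ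
    have hb : 4 + k + 2 * R ^ 2 ≤ (4 + k + 2 * R ^ 2) * L :=
      le_mul_of_one_le_right (by positivity) hL1
    rw [abs_le]
    constructor <;> nlinarith [sq_nonneg (s * Real.cos θ)]
  have hpW : 0 < exitLevel R s k L η θ + rayP R θ := by positivity
  set W := exitLevel R s k L η θ
  set p := rayP R θ
  -- the ratio of `W + p` to its leading term `L ^ 2`
  have hx : |(W + p) / L ^ 2 - 1| ≤ (8 + k + 2 * R ^ 2) / L := by
    have : (W + p) / L ^ 2 - 1 = (W + p - L ^ 2) / L ^ 2 := by field_simp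
    rw [this, abs_div, abs_of_pos (by positivity : 0 < L ^ 2), div_le_div_iff₀ (by positivity) hL0]
    nlinarith
  have hx2 : (8 + k + 2 * R ^ 2) / L ≤ 1 / 2 := by
    rw [div_le_div_iff₀ hL0 two_pos]
    linarith
  have hlog : |Real.log ((W + p) / L ^ 2)| ≤ 2 * ((8 + k + 2 * R ^ 2) / L) :=
    (abs_log_le_two_mul (hx.trans hx2)).trans (by linarith)
  have hWlow : L ≤ 2 * (W + p) := by
    have h1 := (abs_le.1 (hx.trans hx2)).1
    have h2 : 1 / 2 ≤ (W + p) / L ^ 2 := by linarith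
    rw [div_le_div_iff₀ two_pos (by positivity)] at h2
    nlinarith
  have hq : |(rayA R θ - p) * (rayB θ - p)| ≤ R ^ 2 * R ^ 2 := by
    have h1 := Real.cos_sq_le_one θ
    have h2 := Real.sin_sq_le_one θ
    have hp1 : p ≤ R ^ 2 := rayP_le R θ
    have h3 : 0 ≤ (R ^ 2 - 1) * Real.cos θ ^ 2 := mul_nonneg (by linarith) (sq_nonneg _)
    have h4 : (R ^ 2 - 1) * Real.cos θ ^ 2 ≤ R ^ 2 - 1 := mul_le_of_le_one_right (by linarith) h1
    rw [abs_mul]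
    refine mul_le_mul ?_ ?_ (abs_nonneg _) (sq_nonneg _)
    · rw [rayA, abs_le]
      constructor <;> linarith
    · rw [rayB, abs_le]
      constructor <;> linarith [sq_nonneg (Real.sin θ)]
  have hqp : (rayA R θ - p) * (rayB θ - p) / p = (R ^ 2 - 1) / R ^ 2 - rayG R θ - p := by
    have h1 : rayA R θ * rayB θ = (R ^ 2 - 1) / R ^ 2 * p := by
      simp only [rayA, rayB, p, rayP]
      field_simp
    rw [div_eq_iff hp.ne']
    simp only [rayG]
    linear_combination h1
  have hlogW : Real.log (1 + W / p) = Real.log ((W + p) / L ^ 2) + 2 * Real.log L - logRayP R θ := by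
    have h1 : 1 + W / p = (W + p) / p := by field_simp; ring
    rw [h1, Real.log_div hpW.ne' hp.ne', Real.log_div hpW.ne' (by positivity), Real.log_pow,
      log_rayP hR hθ]
    push_cast
    ring
  have hdiff : radialPrimitive (rayA R θ) (rayB θ) p W - rayExpansion R s k L η θ
      = rayG R θ * Real.log ((W + p) / L ^ 2) - (rayA R θ - p) * (rayB θ - p) / (W + p) := by
    have h1 : W / (p * (W + p)) = 1 / p - 1 / (W + p) := by field_simp; ring
    rw [radialPrimitive, rayExpansion, hlogW, ← hqp, h1]
    simp only [rayG]
    ring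
  rw [hdiff]
  calc _ ≤ |rayG R θ * Real.log ((W + p) / L ^ 2)| + |(rayA R θ - p) * (rayB θ - p) / (W + p)| :=
        abs_sub _ _
    _ ≤ (R ^ 2 + 1) * (2 * ((8 + k + 2 * R ^ 2) / L)) + R ^ 2 * R ^ 2 / (L / 2) := by
        rw [abs_mul, abs_div, abs_of_pos hpW]
        gcongr
        · exact abs_rayG_le hR θ
        · linarith
    _ = expansionBound R k / L := by
        unfold expansionBound
        field_simp

/-- The integral over all directions of the radial integral outside an explicitly given disc. -/
theorem exists_lintegral_radialPrimitive {R s k L η : ℝ} (hR : 1 < R) (hs : |s| ≤ 1) (hk : 0 ≤ k)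
    (hL : largeL R k ≤ L) (hη : |η| ≤ 1) :
    ∃ J : ℝ, 0 ≤ J ∧ ∫⁻ θ in Ioo (-Real.pi) Real.pi, ∫⁻ r in Ioi (1 / √(exitLevel R s k L η θ)),
        ENNReal.ofReal (radialKernel (rayA R θ) (rayB θ) (rayP R θ) r) = ENNReal.ofReal J ∧
      |J - (Real.pi * L ^ 2 + Real.pi * η + Real.pi * R ^ 2 * Real.log L / 2 + finitePart R s k)|
        ≤ Real.pi * expansionBound R k / L := by
  set f : ℝ → ℝ := fun θ => 1 / 2 * radialPrimitive (rayA R θ) (rayB θ) (rayP R θ)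
    (exitLevel R s k L η θ) with hf
  set e : ℝ → ℝ := rayExpansion R s k L η with he
  have hpi : -Real.pi ≤ Real.pi := by linarith [Real.pi_pos]
  have hae : ∀ᵐ θ ∂(volume.restrict (Ioo (-Real.pi) Real.pi)), Real.sin (2 * θ) ≠ 0 :=
    ae_restrict_of_ae ae_sin_two_mul_ne_zero
  have hbd : ∀ θ, Real.sin (2 * θ) ≠ 0 → |f θ - 1 / 2 * e θ| ≤ 1 / 2 * (expansionBound R k / L) := by
    intro θ hθ
    have h := abs_radialPrimitive_sub_le hR hs hk hL hη hθ
    rw [hf, ← mul_sub, abs_mul, abs_of_pos (by norm_num : (0 : ℝ) < 1 / 2)]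
    gcongr
  have hray : ∀ θ, Real.sin (2 * θ) ≠ 0 → 0 ≤ f θ ∧
      ∫⁻ r in Ioi (1 / √(exitLevel R s k L η θ)),
        ENNReal.ofReal (radialKernel (rayA R θ) (rayB θ) (rayP R θ) r) = ENNReal.ofReal (f θ) :=
    fun θ hθ => radialPrimitive_nonneg_and_lintegral
      (mul_nonneg (by nlinarith) (sq_nonneg _)) (sq_nonneg _) (rayP_pos hR hθ)
      (exitLevel_pos hs hk hL hη θ)
  have hei : IntegrableOn (fun θ => 1 / 2 * e θ) (Ioo (-Real.pi) Real.pi) :=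
    ((intervalIntegrable_iff_integrableOn_Ioo_of_le hpi).1
      (intervalIntegrable_rayExpansion R s k L η)).const_mul _
  have hfm : Measurable f := by
    have h1 := (continuous_exitLevel R s k L η).measurable
    have h2 := (continuous_rayP R).measurable
    simp only [hf, radialPrimitive, rayA, rayB]
    fun_prop
  have hdi : IntegrableOn (fun θ => f θ - 1 / 2 * e θ) (Ioo (-Real.pi) Real.pi) := by
    refine Integrable.mono' (g := fun _ => 1 / 2 * (expansionBound R k / L))
      (continuous_const.integrableOn_Icc.mono_set Ioo_subset_Icc_self)
      (hfm.aestronglyMeasurable.sub hei.aestronglyMeasurable) ?_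
    filter_upwards [hae] with θ hθ using hbd θ hθ
  have hfi : IntegrableOn f (Ioo (-Real.pi) Real.pi) := by
    have := hdi.add hei
    simpa [Pi.add_def] using this
  refine ⟨∫ θ in Ioo (-Real.pi) Real.pi, f θ, ?_, ?_, ?_⟩
  · refine integral_nonneg_of_ae ?_
    filter_upwards [hae] with θ hθ using (hray θ hθ).1
  · rw [ofReal_integral_eq_lintegral_ofReal hfi]
    · refine lintegral_congr_ae ?_
      filter_upwards [hae] with θ hθ using (hray θ hθ).2
    · filter_upwards [hae] with θ hθ using (hray θ hθ).1
  · have h1 := integral_rayExpansion hR hs hk hL hη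
    rw [intervalIntegral.integral_of_le hpi, integral_Ioc_eq_integral_Ioo] at h1
    have h2 : ∫ θ in Ioo (-Real.pi) Real.pi, 1 / 2 * e θ = Real.pi * L ^ 2 + Real.pi * η
        + Real.pi * R ^ 2 * Real.log L / 2 + finitePart R s k := by
      rw [integral_const_mul, he, h1]
      ring
    rw [← h2, ← integral_sub hfi hei]
    have h3 := norm_setIntegral_le_of_norm_le_const_ae (μ := volume) (s := Ioo (-Real.pi) Real.pi)
      (f := fun θ => f θ - 1 / 2 * e θ) (C := 1 / 2 * (expansionBound R k / L)) (by simp) (by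
        filter_upwards [hae] with θ hθ using hbd θ hθ)
    rw [Real.norm_eq_abs] at h3
    refine h3.trans (le_of_eq ?_)
    rw [Real.volume_real_Ioo_of_le hpi]
    ring

/-- The asymptotic expansion of the integral of the kernel outside the excised disc. -/
theorem exists_abs_truncated_sub_le {R s k : ℝ} (hR : 1 < R) (hs : |s| ≤ 1) (hk : 0 ≤ k) :
    ∃ C : ℝ, ∀ L, largeL R k ≤ L →
      |(∫⁻ z in {z | chordFactor s k z ≤ L ^ 2 * chordForm R z},
          ENNReal.ofReal (torusKernel R z)).toReal
        - (Real.pi * L ^ 2 + Real.pi * R ^ 2 * Real.log L / 2 + finitePart R s k)| ≤ C / L := by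
  refine ⟨Real.pi * (6 * (2 + k) * remBound R k) + Real.pi * expansionBound R k, fun L hL => ?_⟩
  obtain ⟨hη0, hη1⟩ := errWidth_nonneg_and_le_one hk hL
  have hη : |errWidth R k L| ≤ 1 := by rwa [abs_of_nonneg hη0]
  obtain ⟨J, hJ0, hJ, hJb⟩ := exists_lintegral_radialPrimitive hR hs hk hL hη
  obtain ⟨J', hJ'0, hJ', hJ'b⟩ := exists_lintegral_radialPrimitive hR hs hk hL
    (η := -errWidth R k L) (by rwa [abs_neg])
  rw [lintegral_torusKernel_polar]
  set A := ∫⁻ θ in Ioo (-Real.pi) Real.pi, ∫⁻ r in rayCutoff R s k (L ^ 2) θ,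
    ENNReal.ofReal (radialKernel (rayA R θ) (rayB θ) (rayP R θ) r)
  have hup : A ≤ ENNReal.ofReal J := by
    rw [← hJ]
    exact lintegral_mono fun θ => lintegral_mono_set (rayCutoff_bounds hR hs hk hL θ).2
  have hlow : ENNReal.ofReal J' ≤ A := by
    rw [← hJ']
    exact lintegral_mono fun θ => lintegral_mono_set (rayCutoff_bounds hR hs hk hL θ).1
  have hup' : A.toReal ≤ J := ENNReal.toReal_le_of_le_ofReal hJ0 hup
  have hlow' : J' ≤ A.toReal :=
    (ENNReal.ofReal_le_iff_le_toReal (ne_top_of_le_ne_top ENNReal.ofReal_ne_top hup)).1 hlow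
  have h1 := abs_le.1 hJb
  have h2 := abs_le.1 hJ'b
  have h3 : (Real.pi * (6 * (2 + k) * remBound R k) + Real.pi * expansionBound R k) / L
      = Real.pi * errWidth R k L + Real.pi * expansionBound R k / L := by
    unfold errWidth
    ring
  rw [h3, abs_le]
  constructor <;> linarith [h1.2, h2.1]

/-! ### The principal curvatures of the torus -/

theorem partialU_eq {φ : ℝ × ℝ → E3} {z : ℝ × ℝ} {w : E3} (hφ : DifferentiableAt ℝ φ z)
    (h : ∀ i, HasDerivAt (fun u => φ (u, z.2) i) (w i) z.1) : partialU φ z = w := by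
  have h1 : HasDerivAt (fun u : ℝ => (u, z.2)) ((1 : ℝ), (0 : ℝ)) z.1 :=
    (hasDerivAt_id z.1).prodMk (hasDerivAt_const z.1 z.2)
  have h2 : HasDerivAt (fun u => φ (u, z.2)) (partialU φ z) z.1 :=
    HasFDerivAt.comp_hasDerivAt z.1 (f := fun u : ℝ => (u, z.2)) hφ.hasFDerivAt h1
  ext i
  exact ((EuclideanSpace.proj i : E3 →L[ℝ] ℝ).hasFDerivAt.comp_hasDerivAt z.1 h2).unique (h i)

theorem partialV_eq {φ : ℝ × ℝ → E3} {z : ℝ × ℝ} {w : E3} (hφ : DifferentiableAt ℝ φ z)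
    (h : ∀ i, HasDerivAt (fun v => φ (z.1, v) i) (w i) z.2) : partialV φ z = w := by
  have h1 : HasDerivAt (fun v : ℝ => (z.1, v)) ((0 : ℝ), (1 : ℝ)) z.2 :=
    (hasDerivAt_const z.2 z.1).prodMk (hasDerivAt_id z.2)
  have h2 : HasDerivAt (fun v => φ (z.1, v)) (partialV φ z) z.2 :=
    HasFDerivAt.comp_hasDerivAt z.2 (f := fun v : ℝ => (z.1, v)) hφ.hasFDerivAt h1
  ext i
  exact ((EuclideanSpace.proj i : E3 →L[ℝ] ℝ).hasFDerivAt.comp_hasDerivAt z.2 h2).unique (h i)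

theorem contDiff_mk {f₀ f₁ f₂ : ℝ × ℝ → ℝ} {n : WithTop ℕ∞} (h₀ : ContDiff ℝ n f₀)
    (h₁ : ContDiff ℝ n f₁) (h₂ : ContDiff ℝ n f₂) :
    ContDiff ℝ n fun z => (!₂[f₀ z, f₁ z, f₂ z] : E3) := by
  refine contDiff_euclidean.2 fun i => ?_
  fin_cases i
  exacts [h₀, h₁, h₂]

theorem contDiff_torusMap (R : ℝ) {n : WithTop ℕ∞} : ContDiff ℝ n (torusMap R) :=
  contDiff_mk (by fun_prop) (by fun_prop) (by fun_prop)

theorem partialU_mk {f₀ f₁ f₂ : ℝ × ℝ → ℝ} {z : ℝ × ℝ} {a b c : ℝ} (h₀ : ContDiff ℝ 1 f₀)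
    (h₁ : ContDiff ℝ 1 f₁) (h₂ : ContDiff ℝ 1 f₂) (ha : HasDerivAt (fun u => f₀ (u, z.2)) a z.1)
    (hb : HasDerivAt (fun u => f₁ (u, z.2)) b z.1) (hc : HasDerivAt (fun u => f₂ (u, z.2)) c z.1) :
    partialU (fun z => !₂[f₀ z, f₁ z, f₂ z]) z = !₂[a, b, c] := by
  refine partialU_eq ((contDiff_mk h₀ h₁ h₂).differentiable one_ne_zero z) fun i => ?_
  fin_cases i
  exacts [ha, hb, hc]

theorem partialV_mk {f₀ f₁ f₂ : ℝ × ℝ → ℝ} {z : ℝ × ℝ} {a b c : ℝ} (h₀ : ContDiff ℝ 1 f₀)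
    (h₁ : ContDiff ℝ 1 f₁) (h₂ : ContDiff ℝ 1 f₂) (ha : HasDerivAt (fun v => f₀ (z.1, v)) a z.2)
    (hb : HasDerivAt (fun v => f₁ (z.1, v)) b z.2) (hc : HasDerivAt (fun v => f₂ (z.1, v)) c z.2) :
    partialV (fun z => !₂[f₀ z, f₁ z, f₂ z]) z = !₂[a, b, c] := by
  refine partialV_eq ((contDiff_mk h₀ h₁ h₂).differentiable one_ne_zero z) fun i => ?_
  fin_cases i
  exacts [ha, hb, hc]

theorem partialU_torusMap (R : ℝ) : partialU (torusMap R) = fun z =>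
    !₂[-Real.sin z.1 * Real.cos z.2, -Real.sin z.1 * Real.sin z.2, Real.cos z.1] := by
  ext1 z
  exact partialU_mk (by fun_prop) (by fun_prop) (by fun_prop)
    (((Real.hasDerivAt_cos z.1).const_add R).mul_const (Real.cos z.2))
    (((Real.hasDerivAt_cos z.1).const_add R).mul_const (Real.sin z.2)) (Real.hasDerivAt_sin z.1)

theorem partialV_torusMap (R : ℝ) : partialV (torusMap R) = fun z =>
    !₂[(R + Real.cos z.1) * -Real.sin z.2, (R + Real.cos z.1) * Real.cos z.2, 0] := by
  ext1 z
  exact partialV_mk (by fun_prop) (by fun_prop) (by fun_prop)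
    ((Real.hasDerivAt_cos z.2).const_mul (R + Real.cos z.1))
    ((Real.hasDerivAt_sin z.2).const_mul (R + Real.cos z.1)) (hasDerivAt_const z.2 (Real.sin z.1))

theorem partialU_partialU_torusMap (R : ℝ) (z : ℝ × ℝ) : partialU (partialU (torusMap R)) z =
    !₂[-Real.cos z.1 * Real.cos z.2, -Real.cos z.1 * Real.sin z.2, -Real.sin z.1] := by
  rw [partialU_torusMap]
  exact partialU_mk (by fun_prop) (by fun_prop) (by fun_prop)
    ((Real.hasDerivAt_sin z.1).fun_neg.mul_const (Real.cos z.2))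
    ((Real.hasDerivAt_sin z.1).fun_neg.mul_const (Real.sin z.2)) (Real.hasDerivAt_cos z.1)

theorem partialU_partialV_torusMap (R : ℝ) (z : ℝ × ℝ) : partialU (partialV (torusMap R)) z =
    !₂[-Real.sin z.1 * -Real.sin z.2, -Real.sin z.1 * Real.cos z.2, 0] := by
  rw [partialV_torusMap]
  exact partialU_mk (by fun_prop) (by fun_prop) (by fun_prop)
    (((Real.hasDerivAt_cos z.1).const_add R).mul_const (-Real.sin z.2))
    (((Real.hasDerivAt_cos z.1).const_add R).mul_const (Real.cos z.2)) (hasDerivAt_const z.1 0)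

theorem partialV_partialV_torusMap (R : ℝ) (z : ℝ × ℝ) : partialV (partialV (torusMap R)) z =
    !₂[(R + Real.cos z.1) * -Real.cos z.2, (R + Real.cos z.1) * -Real.sin z.2, 0] := by
  rw [partialV_torusMap]
  exact partialV_mk (by fun_prop) (by fun_prop) (by fun_prop)
    ((Real.hasDerivAt_sin z.2).fun_neg.const_mul (R + Real.cos z.1))
    ((Real.hasDerivAt_cos z.2).const_mul (R + Real.cos z.1)) (hasDerivAt_const z.2 0)

theorem inner_mk (a b c a' b' c' : ℝ) :
    ⟪(!₂[a, b, c] : E3), !₂[a', b', c']⟫ = a * a' + b * b' + c * c' := by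
  simp [PiLp.inner_apply, Fin.sum_univ_three]
  ring

theorem sqrt_torusPoint {R : ℝ} (hR : 1 < R) (u v : ℝ) :
    √(torusPoint R u v 0 ^ 2 + torusPoint R u v 1 ^ 2) = R + Real.cos u := by
  have h : torusPoint R u v 0 ^ 2 + torusPoint R u v 1 ^ 2 = (R + Real.cos u) ^ 2 := by
    simp only [torusPoint]
    simp
    linear_combination (R + Real.cos u) ^ 2 * Real.sin_sq_add_cos_sq v
  rw [h, Real.sqrt_sq (by linarith [Real.neg_one_le_cos u])]

/-- A continuous function on space inverting the torus parametrization near `(α, β)`. The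
denominator is bounded away from zero so as to be continuous also on the axis. -/
def torusChart (R α β : ℝ) (y : E3) : ℝ × ℝ :=
  (α + Real.arcsin (y 2 * Real.cos α - (√(y 0 ^ 2 + y 1 ^ 2) - R) * Real.sin α),
    β + Real.arcsin ((y 1 * Real.cos β - y 0 * Real.sin β) / max (√(y 0 ^ 2 + y 1 ^ 2)) (R - 1)))

theorem continuous_torusChart {R : ℝ} (hR : 1 < R) (α β : ℝ) : Continuous (torusChart R α β) := by
  have h : ∀ y : E3, max (√(y 0 ^ 2 + y 1 ^ 2)) (R - 1) ≠ 0 := fun y =>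
    (lt_max_of_lt_right (by linarith)).ne'
  unfold torusChart
  refine Continuous.prodMk ?_ ?_
  · exact continuous_const.add (Real.continuous_arcsin.comp (by fun_prop))
  · exact continuous_const.add (Real.continuous_arcsin.comp (Continuous.div (by fun_prop)
      (by fun_prop) h))

theorem torusChart_torusPoint {R : ℝ} (hR : 1 < R) (α β u v : ℝ) :
    torusChart R α β (torusPoint R u v)
      = (α + Real.arcsin (Real.sin (u - α)), β + Real.arcsin (Real.sin (v - β))) := by
  have hρ : R - 1 ≤ R + Real.cos u := by linarith [Real.neg_one_le_cos u]
  have hρ0 : R + Real.cos u ≠ 0 := by linarith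
  simp only [torusChart, sqrt_torusPoint hR, max_eq_left hρ, Real.sin_sub]
  simp only [torusPoint]
  simp
  congr 1
  field_simp

/-- The open set of parameters on which `torusChart` inverts the torus parametrization. -/
def chartDomain (α β : ℝ) : Set (ℝ × ℝ) :=
  Ioo (α - Real.pi / 2) (α + Real.pi / 2) ×ˢ Ioo (β - Real.pi / 2) (β + Real.pi / 2)

theorem torusChart_torusMap {R : ℝ} (hR : 1 < R) {α β : ℝ} {z : ℝ × ℝ} (hz : z ∈ chartDomain α β) :
    torusChart R α β (torusMap R z) = z := by
  obtain ⟨⟨h1, h2⟩, h3, h4⟩ := hz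
  rw [torusMap, torusChart_torusPoint hR, Real.arcsin_sin (by linarith) (by linarith),
    Real.arcsin_sin (by linarith) (by linarith)]
  simp

theorem cos_sin_add_arcsin_sin {a x : ℝ} (h : 0 < Real.cos (x - a)) :
    Real.cos (a + Real.arcsin (Real.sin (x - a))) = Real.cos x ∧
      Real.sin (a + Real.arcsin (Real.sin (x - a))) = Real.sin x ∧
      a + Real.arcsin (Real.sin (x - a)) ∈ Ioo (a - Real.pi / 2) (a + Real.pi / 2) := by
  have hs : Real.sin (Real.arcsin (Real.sin (x - a))) = Real.sin (x - a) :=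
    Real.sin_arcsin (Real.neg_one_le_sin _) (Real.sin_le_one _)
  have hc : Real.cos (Real.arcsin (Real.sin (x - a))) = Real.cos (x - a) := by
    rw [Real.cos_arcsin, ← Real.cos_sq', Real.sqrt_sq h.le]
  have hx : x = a + (x - a) := by ring
  have hlt : |Real.sin (x - a)| < 1 := by
    rw [← sq_lt_one_iff_abs_lt_one]
    nlinarith [Real.sin_sq_add_cos_sq (x - a)]
  have hlt' := abs_lt.1 hlt
  refine ⟨?_, ?_, ?_, ?_⟩
  · conv_rhs => rw [hx]
    rw [Real.cos_add, Real.cos_add a (x - a), hs, hc]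
  · conv_rhs => rw [hx]
    rw [Real.sin_add, Real.sin_add a (x - a), hs, hc]
  · linarith [Real.neg_pi_div_two_lt_arcsin.2 hlt'.1]
  · linarith [Real.arcsin_lt_pi_div_two.2 hlt'.2]

theorem isLocalParametrization_torusMap {R : ℝ} (hR : 1 < R) (α β : ℝ) :
    IsLocalParametrization (torus R) (torusMap R) (chartDomain α β) where
  isOpen_domain := isOpen_Ioo.prod isOpen_Ioo
  contDiffOn := (contDiff_torusMap R).contDiffOn
  immersion z _ := by
    rw [partialU_torusMap, partialV_torusMap, LinearIndependent.pair_iff]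
    intro a b h
    have h0 := congrArg (fun x : E3 => x 0) h
    have h1 := congrArg (fun x : E3 => x 1) h
    have h2 := congrArg (fun x : E3 => x 2) h
    simp at h0 h1 h2
    have hρ : R + Real.cos z.1 ≠ 0 := by linarith [Real.neg_one_le_cos z.1]
    have hu := Real.sin_sq_add_cos_sq z.1
    have hv := Real.sin_sq_add_cos_sq z.2
    have ha : a * Real.sin z.1 = 0 := by
      linear_combination -Real.cos z.2 * h0 - Real.sin z.2 * h1 - a * Real.sin z.1 * hv
    have hb : b * (R + Real.cos z.1) = 0 := by
      linear_combination -Real.sin z.2 * h0 + Real.cos z.2 * h1 - b * (R + Real.cos z.1) * hv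
    have ha' : a * Real.cos z.1 = 0 := by simpa using h2
    refine ⟨?_, (mul_eq_zero.1 hb).resolve_right hρ⟩
    linear_combination Real.sin z.1 * ha + Real.cos z.1 * ha' - a * hu
  isEmbedding := by
    refine Topology.IsEmbedding.of_comp ((continuous_torusMap R).comp continuous_subtype_val)
      (continuous_torusChart hR α β) ?_
    have h : (torusChart R α β ∘ fun z : chartDomain α β => torusMap R z) = Subtype.val := by
      ext1 z
      exact torusChart_torusMap hR z.2
    rw [h]
    exact Topology.IsEmbedding.subtypeVal
  relOpen_image := by
    -- the image is cut out of the torus by the positivity of `cos (u - α)` and `cos (v - β)`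
    refine ⟨{y | 0 < (√(y 0 ^ 2 + y 1 ^ 2) - R) * Real.cos α + y 2 * Real.sin α} ∩
      {y | 0 < y 0 * Real.cos β + y 1 * Real.sin β}, ?_, ?_⟩
    · have h1 : Continuous fun y : E3 =>
          (√(y 0 ^ 2 + y 1 ^ 2) - R) * Real.cos α + y 2 * Real.sin α := by fun_prop
      have h2 : Continuous fun y : E3 => y 0 * Real.cos β + y 1 * Real.sin β := by fun_prop
      exact (isOpen_lt continuous_const h1).inter (isOpen_lt continuous_const h2)
    have hmem : ∀ u v, torusPoint R u v ∈
        ({y | 0 < (√(y 0 ^ 2 + y 1 ^ 2) - R) * Real.cos α + y 2 * Real.sin α} ∩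
          {y | 0 < y 0 * Real.cos β + y 1 * Real.sin β} : Set E3) ↔
        0 < Real.cos (u - α) ∧ 0 < Real.cos (v - β) := by
      intro u v
      have hρ : 0 < R + Real.cos u := by linarith [Real.neg_one_le_cos u]
      have h1 : torusPoint R u v 0 * Real.cos β + torusPoint R u v 1 * Real.sin β
          = (R + Real.cos u) * Real.cos (v - β) := by
        simp [torusPoint, Real.cos_sub]
        ring
      have h2 : torusPoint R u v 2 = Real.sin u := by simp [torusPoint]
      simp only [mem_inter_iff, mem_ofPred_eq, sqrt_torusPoint hR, h1, h2, mul_pos_iff_of_pos_left hρ,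
        Real.cos_sub u α, add_sub_cancel_left]
    ext y
    constructor
    · rintro ⟨z, ⟨⟨h1, h2⟩, h3, h4⟩, rfl⟩
      refine ⟨⟨z.1, z.2, rfl⟩, (hmem z.1 z.2).2 ⟨?_, ?_⟩⟩ <;>
      exact Real.cos_pos_of_mem_Ioo ⟨by linarith, by linarith⟩
    · rintro ⟨⟨u, v, rfl⟩, hW⟩
      obtain ⟨hu, hv⟩ := (hmem u v).1 hW
      obtain ⟨hu1, hu2, hu3⟩ := cos_sin_add_arcsin_sin hu
      obtain ⟨hv1, hv2, hv3⟩ := cos_sin_add_arcsin_sin hv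
      exact ⟨(_, _), ⟨hu3, hv3⟩, by simp only [torusMap, torusPoint, hu1, hu2, hv1, hv2]⟩

theorem hasPrincipalCurvatures_torus {R : ℝ} (hR : 1 < R) (α β : ℝ) :
    HasPrincipalCurvatures (torus R) (torusPoint R α β) 1 (Real.cos α / (R + Real.cos α)) := by
  have hα := Real.sin_sq_add_cos_sq α
  have hβ := Real.sin_sq_add_cos_sq β
  have hρ : R + Real.cos α ≠ 0 := by linarith [Real.neg_one_le_cos α]
  refine ⟨torusMap R, chartDomain α β, (α, β),
    -- the inward unit normal
    !₂[-Real.cos α * Real.cos β, -Real.cos α * Real.sin β, -Real.sin α],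
    isLocalParametrization_torusMap hR α β, ?_, rfl, ?_, ?_, ?_, ?_⟩
  · have := Real.pi_pos
    exact ⟨⟨by simp; linarith, by simp; linarith⟩, by simp; linarith, by simp; linarith⟩
  · rw [EuclideanSpace.norm_eq, Real.sqrt_eq_one]
    simp [Fin.sum_univ_three]
    linear_combination Real.cos α ^ 2 * hβ + hα
  · simp only [partialU_torusMap, inner_mk]
    linear_combination Real.cos α * Real.sin α * hβ
  · simp only [partialV_torusMap, inner_mk]
    ring
  · intro t
    have e1 : ⟪partialU (torusMap R) (α, β), partialU (torusMap R) (α, β)⟫ = 1 := by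
      simp only [partialU_torusMap, inner_mk]
      linear_combination Real.sin α ^ 2 * hβ + hα
    have e2 : ⟪partialU (torusMap R) (α, β), partialV (torusMap R) (α, β)⟫ = 0 := by
      simp only [partialU_torusMap, partialV_torusMap, inner_mk]
      ring
    have e3 : ⟪partialV (torusMap R) (α, β), partialV (torusMap R) (α, β)⟫
        = (R + Real.cos α) ^ 2 := by
      simp only [partialV_torusMap, inner_mk]
      linear_combination (R + Real.cos α) ^ 2 * hβ
    set n : E3 := !₂[-Real.cos α * Real.cos β, -Real.cos α * Real.sin β, -Real.sin α] with hn
    have e4 : ⟪partialU (partialU (torusMap R)) (α, β), n⟫ = 1 := by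
      simp only [partialU_partialU_torusMap, hn, inner_mk]
      linear_combination Real.cos α ^ 2 * hβ + hα
    have e5 : ⟪partialU (partialV (torusMap R)) (α, β), n⟫ = 0 := by
      simp only [partialU_partialV_torusMap, hn, inner_mk]
      ring
    have e6 : ⟪partialV (partialV (torusMap R)) (α, β), n⟫ = (R + Real.cos α) * Real.cos α := by
      simp only [partialV_partialV_torusMap, hn, inner_mk]
      linear_combination (R + Real.cos α) * Real.cos α * hβ
    simp only [firstForm, secondForm, e1, e2, e3, e4, e5, e6]
    simp [Matrix.det_fin_two]
    field_simp
    ring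

/-! ### The renormalized potential -/

/-- The value of the renormalized potential of the torus on the parallel of angle `α`. -/
def torusPotential (R α : ℝ) : ℝ :=
  3 * Real.pi * R ^ 2 * Real.log 2 / (8 * (R + Real.cos α) ^ 2) - Real.pi / 8
    - Real.pi / (4 * R ^ 2 * (R + Real.cos α) ^ 2)
    + Real.pi * (1 + Real.sin α ^ 2) / (8 * (R + Real.cos α) ^ 2)
    + Real.pi * Real.cos α / (4 * (R + Real.cos α))

theorem measurableSet_torus {R : ℝ} (hR : 1 < R) : MeasurableSet (torus R) := by
  rw [← image_torusMap_periodSquare R 0 0]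
  exact (measurableSet_periodSquare 0 0).image_of_continuousOn_injOn
    (continuous_torusMap R).continuousOn (injOn_torusMap hR 0 0)

theorem euclideanHausdorffMeasure_torus_lt_top {R : ℝ} (hR : 1 < R) : μHE[2] (torus R) < ⊤ := by
  rw [← image_torusMap_periodSquare R 0 0,
    euclideanHausdorffMeasure_image_torusMap hR subset_rfl (measurableSet_periodSquare 0 0)]
  calc ∫⁻ z in periodSquare 0 0, torusDensity R z
      ≤ ∫⁻ _ in periodSquare 0 0, ENNReal.ofReal (R + 1) := by
        refine lintegral_mono fun z => ENNReal.ofReal_le_ofReal ?_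
        linarith [Real.cos_le_one z.1]
    _ < ⊤ := by
        rw [setLIntegral_const, periodSquare, Measure.volume_eq_prod, Measure.prod_prod]
        simp only [Real.volume_Ioc]
        exact ENNReal.mul_lt_top ENNReal.ofReal_lt_top
          (ENNReal.mul_lt_top ENNReal.ofReal_lt_top ENNReal.ofReal_lt_top)

theorem integrableOn_torus_diff_ball {R : ℝ} (hR : 1 < R) (x : E3) {ε : ℝ} (hε : 0 < ε) :
    IntegrableOn (fun y : E3 => 1 / ‖x - y‖ ^ 4) (torus R \ Metric.ball x ε) μHE[2] := by
  refine Measure.integrableOn_of_bounded (M := 1 / ε ^ 4) ?_ ?_ ?_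
  · exact ((measure_mono sdiff_subset).trans_lt (euclideanHausdorffMeasure_torus_lt_top hR)).ne
  · exact (by fun_prop : Measurable fun y : E3 => 1 / ‖x - y‖ ^ 4).aestronglyMeasurable
  · refine (ae_restrict_iff' ((measurableSet_torus hR).diff Metric.isOpen_ball.measurableSet)).2
      (Eventually.of_forall fun y hy => ?_)
    have h : ε ≤ ‖x - y‖ := by
      rw [← dist_eq_norm, dist_comm]
      exact not_lt.1 hy.2
    rw [Real.norm_of_nonneg (by positivity)]
    gcongr

theorem truncatedPotential_torus {R : ℝ} (hR : 1 < R) (α β : ℝ) {ε : ℝ} (hε : 0 < ε) :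
    truncatedPotential (torus R) (torusPoint R α β) ε = 1 / (4 * (R + Real.cos α) ^ 2) *
      (∫⁻ z in {z | chordFactor (Real.sin α) (Real.sin α ^ 2 + (R + Real.cos α) ^ 2) z
        ≤ (2 * (R + Real.cos α) / ε) ^ 2 * chordForm R z}, ENNReal.ofReal (torusKernel R z)).toReal := by
  have h := lintegral_torus_diff_ball hR α β hε
  have hL : 4 * (R + Real.cos α) ^ 2 / ε ^ 2 = (2 * (R + Real.cos α) / ε) ^ 2 := by ring
  rw [truncatedPotential, integral_eq_lintegral_of_nonneg_ae
    (Eventually.of_forall fun y => by positivity)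
    (by fun_prop : Measurable fun y : E3 => 1 / ‖torusPoint R α β - y‖ ^ 4).aestronglyMeasurable,
    h, ENNReal.toReal_mul, ENNReal.toReal_ofReal (by positivity), hL]

/-- The difference between the renormalized truncated potential and its limit. -/
theorem renormalized_sub_torusPotential {R : ℝ} (hR : 1 < R) (α : ℝ) {ε : ℝ} (hε : 0 < ε) (A : ℝ) :
    1 / (4 * (R + Real.cos α) ^ 2) * A - Real.pi / ε ^ 2
      + Real.pi * (1 - Real.cos α / (R + Real.cos α)) ^ 2 / 16
        * Real.log ((1 - Real.cos α / (R + Real.cos α)) ^ 2 * ε ^ 2)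
      + Real.pi * (1 * (Real.cos α / (R + Real.cos α))) / 4 - torusPotential R α
    = 1 / (4 * (R + Real.cos α) ^ 2) * (A - (Real.pi * (2 * (R + Real.cos α) / ε) ^ 2
      + Real.pi * R ^ 2 * Real.log (2 * (R + Real.cos α) / ε) / 2
      + finitePart R (Real.sin α) (Real.sin α ^ 2 + (R + Real.cos α) ^ 2))) := by
  have hc : 0 < R + Real.cos α := by linarith [Real.neg_one_le_cos α]
  have hκ : 1 - Real.cos α / (R + Real.cos α) = R / (R + Real.cos α) := by
    field_simp
    ring
  have hlog1 : Real.log ((R / (R + Real.cos α)) ^ 2 * ε ^ 2)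
      = 2 * (Real.log R - Real.log (R + Real.cos α) + Real.log ε) := by
    rw [← mul_pow, Real.log_pow, Real.log_mul (by positivity) hε.ne',
      Real.log_div (by positivity) hc.ne']
    push_cast
    ring
  have hlog2 : Real.log (2 * (R + Real.cos α) / ε)
      = Real.log 2 + Real.log (R + Real.cos α) - Real.log ε := by
    rw [Real.log_div (by positivity) hε.ne', Real.log_mul two_ne_zero hc.ne']
  rw [hκ, hlog1, hlog2, torusPotential, finitePart]
  generalize Real.log (R + Real.cos α) = l
  field_simp
  ring

theorem hasRenormalizedPotential_torus {R : ℝ} (hR : 1 < R) (α β : ℝ) :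
    HasRenormalizedPotential (torus R) (torusPoint R α β) (torusPotential R α) := by
  refine ⟨1, Real.cos α / (R + Real.cos α), hasPrincipalCurvatures_torus hR α β,
    fun ε hε => integrableOn_torus_diff_ball hR _ hε, ?_⟩
  have hc : 0 < R + Real.cos α := by linarith [Real.neg_one_le_cos α]
  obtain ⟨C, hC⟩ := exists_abs_truncated_sub_le hR (Real.abs_sin_le_one α)
    (by positivity : 0 ≤ Real.sin α ^ 2 + (R + Real.cos α) ^ 2)
  have hL : Tendsto (fun ε : ℝ => 2 * (R + Real.cos α) / ε) (𝓝[>] 0) atTop :=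
    tendsto_inv_nhdsGT_zero.const_mul_atTop (by positivity)
  have hlim : Tendsto (fun ε : ℝ => 1 / (4 * (R + Real.cos α) ^ 2) *
      (C / (2 * (R + Real.cos α) / ε))) (𝓝[>] 0) (𝓝 0) := by
    have h := (hL.const_div_atTop C).const_mul (1 / (4 * (R + Real.cos α) ^ 2))
    rwa [mul_zero] at h
  rw [tendsto_iff_norm_sub_tendsto_zero]
  refine squeeze_zero' (Eventually.of_forall fun ε => norm_nonneg _) ?_ hlim
  filter_upwards [self_mem_nhdsWithin, hL.eventually_ge_atTop
    (largeL R (Real.sin α ^ 2 + (R + Real.cos α) ^ 2))] with ε hε hεL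
  rw [truncatedPotential_torus hR α β hε, renormalized_sub_torusPotential hR α hε, norm_mul,
    Real.norm_of_nonneg (by positivity), Real.norm_eq_abs]
  gcongr
  exact hC _ hεL

/-! ### The energy -/

/-- The primitive is smooth on the whole line because the usual half-angle tangent is replaced by
a combination of `u` and an arctangent of a bounded function. -/
theorem hasDerivAt_primitive_inv_add_cos {R : ℝ} (hR : 1 < R) (u : ℝ) :
    HasDerivAt (fun u => u / √(R ^ 2 - 1)
      - 2 / √(R ^ 2 - 1) * Real.arctan (Real.sin u / (R + √(R ^ 2 - 1) + Real.cos u)))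
      (1 / (R + Real.cos u)) u := by
  have hR2 : 0 < R ^ 2 - 1 := by nlinarith
  have hq : 0 < √(R ^ 2 - 1) := Real.sqrt_pos.2 hR2
  have hq2 : √(R ^ 2 - 1) ^ 2 = R ^ 2 - 1 := Real.sq_sqrt hR2.le
  set q := √(R ^ 2 - 1)
  have hρ : 0 < R + Real.cos u := by linarith [Real.neg_one_le_cos u]
  have hD : 0 < R + q + Real.cos u := by linarith
  have h1 := ((Real.hasDerivAt_sin u).div ((Real.hasDerivAt_cos u).const_add (R + q)) hD.ne').arctan
  refine (((hasDerivAt_id u).div_const q).sub (h1.const_mul (2 / q))).congr_deriv ?_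
  have hsc := Real.sin_sq_add_cos_sq u
  have h2 : 1 + (Real.sin u / (R + q + Real.cos u)) ^ 2
      = 2 * (R + q) * (R + Real.cos u) / (R + q + Real.cos u) ^ 2 := by
    field_simp
    linear_combination hsc + hq2
  have h3 : Real.cos u * (R + q + Real.cos u) - Real.sin u * -Real.sin u
      = (R + q) * (Real.cos u + R - q) := by
    linear_combination hsc + hq2
  have hRq : 0 < R + q := by linarith
  simp only [Pi.div_apply]
  rw [h2, h3]
  field_simp
  ring

theorem integral_inv_add_cos {R : ℝ} (hR : 1 < R) :
    ∫ u in -Real.pi..Real.pi, 1 / (R + Real.cos u) = 2 * Real.pi / √(R ^ 2 - 1) := by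
  have hcont : Continuous fun u : ℝ => 1 / (R + Real.cos u) :=
    continuous_const.div (by fun_prop) fun u => by linarith [Real.neg_one_le_cos u]
  rw [intervalIntegral.integral_eq_sub_of_hasDerivAt
    (fun u _ => hasDerivAt_primitive_inv_add_cos hR u) (hcont.intervalIntegrable _ _)]
  simp
  ring

/-- The potential times the area density is a constant multiple of `1 / (R + cos α)`. -/
theorem add_cos_mul_torusPotential {R : ℝ} (hR : 1 < R) (α : ℝ) :
    (R + Real.cos α) * torusPotential R α
      = (3 * Real.pi * R ^ 2 * Real.log 2 / 8 - Real.pi / (4 * R ^ 2)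
        + Real.pi * (2 - R ^ 2) / 8) * (1 / (R + Real.cos α)) := by
  have hc : 0 < R + Real.cos α := by linarith [Real.neg_one_le_cos α]
  have hs : Real.sin α ^ 2 = 1 - Real.cos α ^ 2 := Real.sin_sq α
  rw [torusPotential, hs]
  field_simp
  ring

/-- The potential as a function on space, through the distance from the axis and the height. -/
def torusPotentialFun (R : ℝ) (y : E3) : ℝ :=
  3 * Real.pi * R ^ 2 * Real.log 2 / (8 * √(y 0 ^ 2 + y 1 ^ 2) ^ 2) - Real.pi / 8
    - Real.pi / (4 * R ^ 2 * √(y 0 ^ 2 + y 1 ^ 2) ^ 2)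
    + Real.pi * (1 + y 2 ^ 2) / (8 * √(y 0 ^ 2 + y 1 ^ 2) ^ 2)
    + Real.pi * (√(y 0 ^ 2 + y 1 ^ 2) - R) / (4 * √(y 0 ^ 2 + y 1 ^ 2))

theorem measurable_torusPotentialFun (R : ℝ) : Measurable (torusPotentialFun R) := by
  unfold torusPotentialFun
  fun_prop

theorem torusPotentialFun_torusPoint {R : ℝ} (hR : 1 < R) (α β : ℝ) :
    torusPotentialFun R (torusPoint R α β) = torusPotential R α := by
  have h2 : torusPoint R α β 2 = Real.sin α := by simp [torusPoint]
  rw [torusPotentialFun, sqrt_torusPoint hR, h2, torusPotential, add_sub_cancel_left]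

theorem hasRenormalizedEnergy_torus {R : ℝ} (hR : 1 < R) :
    HasRenormalizedEnergy (torus R) (Real.pi ^ 3 / (2 * √(R ^ 2 - 1))
      * (R ^ 2 * (3 * Real.log 2 - 1) + 2 - 2 / R ^ 2)) := by
  set A₀ := 3 * Real.pi * R ^ 2 * Real.log 2 / 8 - Real.pi / (4 * R ^ 2)
    + Real.pi * (2 - R ^ 2) / 8 with hA₀
  have hpull : ∀ z : ℝ × ℝ, (torusDensity R z).toReal • torusPotentialFun R (torusMap R z)
      = A₀ * (1 / (R + Real.cos z.1)) := by
    intro z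
    rw [torusDensity, ENNReal.toReal_ofReal (by linarith [Real.neg_one_le_cos z.1]), torusMap,
      torusPotentialFun_torusPoint hR, smul_eq_mul, add_cos_mul_torusPotential hR]
  have hcont : Continuous fun u : ℝ => 1 / (R + Real.cos u) :=
    continuous_const.div (by fun_prop) fun u => by linarith [Real.neg_one_le_cos u]
  have hlt : ∀ᵐ z ∂(volume.restrict (periodSquare 0 0)), torusDensity R z < ⊤ :=
    Eventually.of_forall fun _ => ENNReal.ofReal_lt_top
  have hVm : AEStronglyMeasurable (torusPotentialFun R)
      (Measure.map (torusMap R) ((volume.restrict (periodSquare 0 0)).withDensity (torusDensity R))) :=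
    (measurable_torusPotentialFun R).aestronglyMeasurable
  refine ⟨torusPotentialFun R, ?_, ?_, ?_⟩
  · rintro _ ⟨α, β, rfl⟩
    rw [torusPotentialFun_torusPoint hR]
    exact hasRenormalizedPotential_torus hR α β
  · rw [IntegrableOn, ← map_withDensity_torusMap hR 0 0,
      integrable_map_measure hVm (continuous_torusMap R).measurable.aemeasurable,
      integrable_withDensity_iff_integrable_smul' (measurable_torusDensity R) hlt]
    simp only [Function.comp_apply, hpull]
    have hcont' : Continuous fun z : ℝ × ℝ => A₀ * (1 / (R + Real.cos z.1)) :=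
      (hcont.comp continuous_fst).const_mul A₀
    exact (hcont'.continuousOn.integrableOn_compact (isCompact_Icc.prod isCompact_Icc)).mono_set
      (prod_mono Ioc_subset_Icc_self Ioc_subset_Icc_self)
  · rw [← map_withDensity_torusMap hR 0 0,
      integral_map (continuous_torusMap R).measurable.aemeasurable hVm,
      integral_withDensity_eq_integral_toReal_smul (measurable_torusDensity R) hlt]
    simp only [hpull]
    have hpi : -Real.pi ≤ Real.pi := by linarith [Real.pi_pos]
    have hprod := setIntegral_prod_mul (μ := volume) (ν := volume)
      (fun u : ℝ => A₀ * (1 / (R + Real.cos u))) (fun _ : ℝ => (1 : ℝ))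
      (Ioc (0 - Real.pi) (0 + Real.pi)) (Ioc (0 - Real.pi) (0 + Real.pi))
    simp only [mul_one] at hprod
    rw [periodSquare, Measure.volume_eq_prod, hprod, integral_const_mul, zero_sub, zero_add,
      ← intervalIntegral.integral_of_le hpi, integral_inv_add_cos hR]
    simp only [integral_const, MeasurableSet.univ, measureReal_restrict_apply, univ_inter,
      Real.volume_real_Ioc_of_le hpi, smul_eq_mul, hA₀]
    have hq : √(R ^ 2 - 1) ≠ 0 := (Real.sqrt_pos.2 (by nlinarith)).ne'
    field_simp
    ring

end RenormalizedEnergy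
end

theorem mainTheorem1 (R : ℝ) (hR : 1 < R) :
    (∀ α β : ℝ, RenormalizedEnergy.HasRenormalizedPotential (RenormalizedEnergy.torus R)
      (RenormalizedEnergy.torusPoint R α β)
      (3 * Real.pi * R ^ 2 * Real.log 2 / (8 * (R + Real.cos α) ^ 2) - Real.pi / 8
        - Real.pi / (4 * R ^ 2 * (R + Real.cos α) ^ 2)
        + Real.pi * (1 + Real.sin α ^ 2) / (8 * (R + Real.cos α) ^ 2)
        + Real.pi * Real.cos α / (4 * (R + Real.cos α)))) ∧
    RenormalizedEnergy.HasRenormalizedEnergy (RenormalizedEnergy.torus R)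
      (Real.pi ^ 3 / (2 * Real.sqrt (R ^ 2 - 1))
        * (R ^ 2 * (3 * Real.log 2 - 1) + 2 - 2 / R ^ 2)) :=
  ⟨fun α β => RenormalizedEnergy.hasRenormalizedPotential_torus hR α β,
    RenormalizedEnergy.hasRenormalizedEnergy_torus hR⟩
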